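/- Let $\mathcal S,\mathcal A$ be measurable spaces with $\sigma$-finite reference measures $\nu_S,\nu_A$ (e.g. counting measures in the discrete case), $T\in\mathbb N$ the number of periods, $\alpha\in(0,1)$. For $t\in\{0,\dots,T-1\}$ let $\mathbb P_t(s'\mid s,a)$ be transition densities with respect to $\nu_S$, $\pi^\theta_t(a\mid s)$, $\theta\in\mathbb R^d$, randomised policies given by densities with respect to $\nu_A$, and $c_t(s,a,s')\in\mathbb R$ costs, all jointly measurable for fixed $\theta$ (time dependence amounts to time being a component of the state). Write $\mathbb P_t^\theta(a,s'\mid s)=\mathbb P_t(s'\mid s,a)\,\pi_t^\theta(a\mid s)$, let $(a_t,s_{t+1})\sim\mathbb P^\theta_t(\cdot,\cdot\mid s_t)$ given $s_t$, and put $c_t=c_t(s_t,a_t,s_{t+1})$. Let $\mathrm{VaR}_u$ be the (lower) $u$-quantile and $\mathrm{CVaR}_\alpha(Z)=\frac1{1-\alpha}\int_\alpha^1\mathrm{VaR}_u(Z)\,du$. Define the value function of the dynamic CVaR by $V_T=0$ and $$V_t(s;\theta)=\mathrm{CVaR}_\alpha(X_t^\theta\mid s_t=s),\qquad X_t^\theta=c_t+V_{t+1}(s_{t+1};\theta),\qquad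 0\le t\le T-1,$$ so that $X_{T-1}^\theta=c_{T-1}$; $X_t^\theta$ is the running risk-to-go. For given $(t,s,\theta)$, with $\mathbb E=\mathbb E_{\mathbb P^\theta_t(\cdot,\cdot\mid s)}$, a saddle-point is a pair $(\xi^*,\lambda^*)$, where $\xi^*=\xi^*(a,s')$ takes values in $[0,\frac1{1-\alpha}]$ almost surely and $\lambda^*\in\mathbb R$, which maximises in $\xi$ (among such random variables) and minimises in $\lambda\in\mathbb R$ the Lagrangian $$L(\xi,\lambda)=\mathbb E[X_t^\theta\,\xi]-\lambda\,(\mathbb E[\xi]-1)$$ of the dual representation of $\mathrm{CVaR}_\alpha(X_t^\theta\mid s_t=s)$. Fix $\theta$ and assume: 1. for all $t,s,a,s'$ such that $\mathbb P_t^{\theta'}(a,s'\mid s)\neq0$ for some $\theta'$, it is non-zero for all $\theta'\in\mathbb R^d$ and $\theta'\mapsto\log\mathbb P_t^{\theta'}(a,s'\mid s)$ is differentiable; and the gradient of this function is bounded, uniformly in $(t,s,a,s')$ and in $\theta'$ in a neighbourhood of $\theta$; 2. the costs have finite first moments: $\mathbb E_\theta\big[\sum_{\tau=t}^{T-1}|c_\tau|\,\big|\,s_t=s\big]<\infty$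 for all $t\le T-1$ and $s$; 3. for all $t\le T-1$ and $s$, the $\alpha$-quantile of $X_t^\theta$ given $s_t=s$ is unique; 4. for all $t<T-1$ and $s$, the distribution of the next state reweighted by $\xi^*$, i.e. $B\mapsto\mathbb E[\xi^*(a_t,s_{t+1})\mathbf 1_B(s_{t+1})]$, is the same for all saddle-points (for instance because $\xi^*$ is almost surely unique, as when the distribution function of $X_t^\theta$ given $s_t=s$ is continuous). Then for all $t\le T-1$ and $s\in\mathcal S$ a saddle-point exists, and every saddle-point $(\xi^*,\lambda^*)$ satisfies the following. The number $\lambda^*$ is an $\alpha$-quantile of $X_t^\theta$ given $s_t=s$. If $t=T-1$, then $V_{T-1}(s;\cdot)$ is differentiable at $\theta$ and $$\nabla_\theta V_{T-1}(s;\theta)=\frac1{1-\alpha}\,\mathbb E\Big[(c_{T-1}-\lambda^*)_+\,\nabla_\theta\log\pi_{T-1}^\theta(a_{T-1}\mid s)\Big].$$ If $t<T-1$, then $V_t(s;\cdot)$ is differentiable at $\theta$ and $$\nabla_\theta V_t(s;\theta)=\frac1{1-\alpha}\,\mathbb E\Big[(c_t+V_{t+1}(s_{t+1};\theta)-\lambda^*)_+\,\nabla_\theta\log\pi_t^\theta(a_t\mid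 s)\Big]+\mathbb E\Big[\nabla_\theta V_{t+1}(s_{t+1};\theta)\;\xi^*(a_t,s_{t+1})\Big].$$ All these expectations are of integrable random variables. -/

import Mathlib

open MeasureTheory Filter Topology
open scoped ENNReal

noncomputable section

/-- Value-at-risk: the (lower) `u`-quantile of the distribution of `Z` under `μ`. -/
def VaR {Ω : Type*} [MeasurableSpace Ω] (μ : Measure Ω) (Z : Ω → ℝ) (u : ℝ) : ℝ :=
  sInf {x : ℝ | u ≤ μ.real {ω | Z ω ≤ x}}

/-- Conditional value-at-risk at threshold `α`: the average of the value-at-risk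
over the levels in `(α, 1)`. -/
def CVaR {Ω : Type*} [MeasurableSpace Ω] (μ : Measure Ω) (Z : Ω → ℝ) (α : ℝ) : ℝ :=
  (1 / (1 - α)) * ∫ u in α..1, VaR μ Z u

/-- `q` is an `α`-quantile (not necessarily the lower one) of `Z` under `μ`. -/
def IsQuantile {Ω : Type*} [MeasurableSpace Ω] (μ : Measure Ω) (Z : Ω → ℝ) (α q : ℝ) : Prop :=
  μ.real {ω | Z ω < q} ≤ α ∧ α ≤ μ.real {ω | Z ω ≤ q}

/-- The Lagrangian `E[Z ξ] - l (E[ξ] - 1)` of the problem of maximising `E[Z ξ]` over the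
`ξ` with values in `[0, 1/(1-α)]` such that `E[ξ] = 1`. -/
def lagrangian {Ω : Type*} [MeasurableSpace Ω] (μ : Measure Ω) (Z : Ω → ℝ)
    (ξ : Ω → ℝ) (l : ℝ) : ℝ :=
  ∫ ω, Z ω * ξ ω ∂μ - l * (∫ ω, ξ ω ∂μ - 1)

/-- Random variables with values in `[0, 1/(1-α)]`, almost surely. -/
def IsBoxed {Ω : Type*} [MeasurableSpace Ω] (μ : Measure Ω) (α : ℝ) (ξ : Ω → ℝ) : Prop :=
  AEMeasurable ξ μ ∧ ∀ᵐ ω ∂μ, 0 ≤ ξ ω ∧ ξ ω ≤ 1 / (1 - α)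

/-- Saddle-points of the Lagrangian of the dual representation of `CVaR`: maximal in `ξ`
(only the box constraint is kept), minimal in the multiplier `l` of the constraint `E[ξ] = 1`. -/
def IsSaddlePoint {Ω : Type*} [MeasurableSpace Ω] (μ : Measure Ω) (Z : Ω → ℝ) (α : ℝ)
    (ξ : Ω → ℝ) (l : ℝ) : Prop :=
  IsBoxed μ α ξ ∧
    (∀ η : Ω → ℝ, IsBoxed μ α η → lagrangian μ Z η l ≤ lagrangian μ Z ξ l) ∧
    ∀ m : ℝ, lagrangian μ Z ξ l ≤ lagrangian μ Z ξ m

/-- A Markov decision process with costs, together with randomised policies indexed by a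
parameter in `Θ`. Transition probabilities and policies are given by densities with respect
to reference measures `νA` on the actions and `νS` on the states (counting measures give the
discrete case). The data may depend on the time `t`. -/
structure ParamMDP (Θ : Type*) {A S : Type*} [MeasurableSpace A] [MeasurableSpace S]
    (νA : Measure A) (νS : Measure S) where
  /-- `trans t s a s'` is the density at `s'` of the next state, given state `s`, action `a` -/
  trans : ℕ → S → A → S → ℝ
  /-- `policy t θ s a` is the density at `a` of the action taken in the state `s` -/
  policy : ℕ → Θ → S → A → ℝ
  /-- `cost t s a s'` is the cost of the transition -/
  cost : ℕ → S → A → S → ℝ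
  measurable_trans : ∀ t, Measurable fun x : S × A × S => trans t x.1 x.2.1 x.2.2
  measurable_policy : ∀ t θ, Measurable fun x : S × A => policy t θ x.1 x.2
  measurable_cost : ∀ t, Measurable fun x : S × A × S => cost t x.1 x.2.1 x.2.2
  trans_nonneg : ∀ t s a s', 0 ≤ trans t s a s'
  policy_nonneg : ∀ t θ s a, 0 ≤ policy t θ s a
  lintegral_trans : ∀ t s a, ∫⁻ s', ENNReal.ofReal (trans t s a s') ∂νS = 1
  lintegral_policy : ∀ t θ s, ∫⁻ a, ENNReal.ofReal (policy t θ s a) ∂νA = 1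

namespace ParamMDP

variable {Θ A S : Type*} [MeasurableSpace A] [MeasurableSpace S]
  {νA : Measure A} {νS : Measure S}

/-- The transition probability (density) of the pair (action, next state), given the state. -/
def prob (M : ParamMDP Θ νA νS) (t : ℕ) (θ : Θ) (s : S) (a : A) (s' : S) : ℝ :=
  M.trans t s a s' * M.policy t θ s a

/-- The law of the pair (action, next state), given the state `s` at time `t`. -/
def law (M : ParamMDP Θ νA νS) (t : ℕ) (θ : Θ) (s : S) : Measure (A × S) :=
  (νA.prod νS).withDensity fun x => ENNReal.ofReal (M.prob t θ s x.1 x.2)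

/-- The dynamic `CVaR` of the costs of the last `k` of `T` periods. -/
def valueAux (M : ParamMDP Θ νA νS) (T : ℕ) (α : ℝ) (θ : Θ) : ℕ → S → ℝ
  | 0, _ => 0
  | k + 1, s => CVaR (M.law (T - (k + 1)) θ s)
      (fun x => M.cost (T - (k + 1)) s x.1 x.2 + valueAux M T α θ k x.2) α

/-- The value function at time `t` of the problem with periods `0, …, T - 1`
(zero at the terminal time `T`). -/
def value (M : ParamMDP Θ νA νS) (T : ℕ) (α : ℝ) (t : ℕ) (s : S) (θ : Θ) : ℝ :=
  M.valueAux T α θ (T - t) s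

/-- The running risk-to-go: the current cost plus the value of the next state. -/
def riskToGo (M : ParamMDP Θ νA νS) (T : ℕ) (α : ℝ) (t : ℕ) (s : S) (θ : Θ) (x : A × S) : ℝ :=
  M.cost t s x.1 x.2 + M.value T α (t + 1) x.2 θ

/-- The conditional expectation, given the state, of the sum of the absolute values of the
costs of the last `k` of `T` periods. -/
def absCostAux (M : ParamMDP Θ νA νS) (T : ℕ) (θ : Θ) : ℕ → S → ℝ≥0∞
  | 0, _ => 0
  | k + 1, s => ∫⁻ x, (‖M.cost (T - (k + 1)) s x.1 x.2‖ₑ + absCostAux M T θ k x.2)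
      ∂(M.law (T - (k + 1)) θ s)

/-- The conditional expectation of `|c_t| + … + |c_{T-1}|`, given the state `s` at time `t`. -/
def absCost (M : ParamMDP Θ νA νS) (T : ℕ) (t : ℕ) (s : S) (θ : Θ) : ℝ≥0∞ :=
  M.absCostAux T θ (T - t) s

theorem value_terminal (M : ParamMDP Θ νA νS) (T : ℕ) (α : ℝ) (s : S) (θ : Θ) :
    M.value T α T s θ = 0 := by
  simp [value, valueAux]

/-- The dynamic programming equation. -/
theorem value_eq (M : ParamMDP Θ νA νS) {T t : ℕ} (ht : t < T) (α : ℝ) (s : S) (θ : Θ) :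
    M.value T α t s θ = CVaR (M.law t θ s) (M.riskToGo T α t s θ) α := by
  obtain ⟨k, rfl⟩ := Nat.exists_eq_add_of_lt ht
  have h1 : t + k + 1 - t = k + 1 := by omega
  have h2 : t + k + 1 - (t + 1) = k := by omega
  have h3 : t + k + 1 - (k + 1) = t := by omega
  unfold value riskToGo value
  rw [h1, h2, valueAux, h3]

end ParamMDP

end

/-! CVaR is the value of a linear maximisation over densities, so its derivative is given by an
envelope theorem: differentiate the Lagrangian in the parameter and evaluate it at a saddle-point.
The dynamic statement follows by backward induction in time.

Static duality. By the quantile transform, CVaR is the value at VaR of the Rockafellar-Uryasev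
objective `ruObjective`. For every `ξ` with values in `[0, 1/(1-α)]` the Lagrangian at `l` is at
most this objective, with equality iff `(Z - l) ξ = (Z - l)₊ / (1-α)` almost surely. Saddle-points
are therefore the `ξ` of mean one satisfying this complementarity (`isSaddlePoint_iff`); they exist
at each quantile `l`, and CVaR equals `E[Z ξ]`.

Envelope theorem (`hasGradientAt_CVaR`). All laws near `θ` are written as densities with respect to
the law at `θ`. Inserting the saddle-point at `θ` into the problem at `η`, and conversely, bounds
the increment of CVaR below and above by increments of Lagrangians, whose first order expansion is
uniform in `ξ`. Two limits remain. The quantiles at `η` converge to the unique quantile at `θ`,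
because they minimise convex objectives that converge pointwise. The maximisers at `η` need not
converge, since `ξ` is not determined on `{Z = l}`; but they approach the set of saddle-points at
`θ` in mean (`exists_isSaddlePoint_near`), and on this set the gradient integral is constant:
complementarity fixes its score part, and uniqueness of the reweighted law of the next state fixes
the other part.

Induction. To apply the envelope theorem at time `t`, the value function at `t + 1` must be
measurable, differentiable at `θ`, and bounded and Lipschitz near `θ` with an integrable constant.
The expected absolute future cost under `θ` serves as that constant, up to a factor: all estimates
of CVaR are homogeneous in the dominating function `W`, so the form of the bound is reproduced one
period earlier (`ValueRegularAt.backward`). -/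

noncomputable section

/-! ### Quantiles and the quantile transform -/

section ValueAtRisk

open ProbabilityTheory Set

variable {Ω : Type*} [MeasurableSpace Ω] {μ : Measure Ω} [IsProbabilityMeasure μ] {Z : Ω → ℝ}
  {α : ℝ}

theorem cdf_map_eq_real (hZ : Measurable Z) (x : ℝ) :
    cdf (μ.map Z) x = μ.real {ω | Z ω ≤ x} := by
  have := Measure.isProbabilityMeasure_map (μ := μ) hZ.aemeasurable
  rw [cdf_eq_real, map_measureReal_apply hZ measurableSet_Iic]
  rfl

/-- Right-continuity of the distribution function makes the infimum in `VaR` attained. The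
restriction to `0 < u < 1` keeps the set nonempty and bounded below, so that `sInf` is not a default
value. -/
theorem VaR_le_iff (hZ : Measurable Z) {u : ℝ} (hu0 : 0 < u) (hu1 : u < 1) {x : ℝ} :
    VaR μ Z u ≤ x ↔ u ≤ μ.real {ω | Z ω ≤ x} := by
  simp only [VaR, ← cdf_map_eq_real hZ]
  set F := cdf (μ.map Z)
  obtain ⟨b, hb⟩ := ((tendsto_cdf_atBot (μ.map Z)).eventually (gt_mem_nhds hu0)).exists
  obtain ⟨c, hc⟩ := ((tendsto_cdf_atTop (μ.map Z)).eventually (lt_mem_nhds hu1)).exists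
  have hne : {x | u ≤ F x}.Nonempty := ⟨c, hc.le⟩
  have hbd : BddBelow {x | u ≤ F x} :=
    ⟨b, fun y hy => le_of_not_gt fun h => (((monotone_cdf _) h.le).trans_lt hb).not_ge hy⟩
  refine ⟨fun h => ?_, fun h => csInf_le hbd h⟩
  refine le_trans ?_ (monotone_cdf (μ.map Z) h)
  have hright : Tendsto F (𝓝[>] (sInf {x | u ≤ F x})) (𝓝 (F (sInf {x | u ≤ F x}))) :=
    ((F.right_continuous _).mono Ioi_subset_Ici_self)
  refine ge_of_tendsto hright ?_
  filter_upwards [self_mem_nhdsWithin] with y hy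
  obtain ⟨z, hz, hzy⟩ := (csInf_lt_iff hbd hne).1 hy
  exact le_trans hz (monotone_cdf _ hzy.le)

theorem isQuantile_VaR (hZ : Measurable Z) (hα0 : 0 < α) (hα1 : α < 1) :
    IsQuantile μ Z α (VaR μ Z α) := by
  refine ⟨?_, (VaR_le_iff hZ hα0 hα1).1 le_rfl⟩
  have := Measure.isProbabilityMeasure_map (μ := μ) hZ.aemeasurable
  -- The mass strictly below the VaR is a left limit of the distribution function, which is less
  -- than `α` at every point to the left.
  have h1 : μ.real {ω | Z ω < VaR μ Z α} = Function.leftLim (cdf (μ.map Z)) (VaR μ Z α) := by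
    have h2 := (cdf (μ.map Z)).measure_Iio (tendsto_cdf_atBot _) (VaR μ Z α)
    rw [measure_cdf, Measure.map_apply hZ measurableSet_Iio, sub_zero] at h2
    have h3 : {ω | Z ω < VaR μ Z α} = Z ⁻¹' Iio (VaR μ Z α) := rfl
    rw [measureReal_def, h3, h2, ENNReal.toReal_ofReal]
    exact (cdf_nonneg (μ.map Z) (VaR μ Z α - 1)).trans
      ((monotone_cdf (μ.map Z)).le_leftLim (by linarith))
  rw [h1]
  refine le_of_tendsto ((monotone_cdf (μ.map Z)).tendsto_leftLim _) ?_
  filter_upwards [self_mem_nhdsWithin] with y hy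
  rw [cdf_map_eq_real hZ]
  by_contra! h
  exact absurd ((VaR_le_iff hZ hα0 hα1).2 h.le) (not_le.2 hy)

theorem monotoneOn_VaR (hZ : Measurable Z) : MonotoneOn (VaR μ Z) (Ioo 0 1) := fun _ hu _ hv h =>
  (VaR_le_iff hZ hu.1 hu.2).2 (h.trans ((VaR_le_iff hZ hv.1 hv.2).1 le_rfl))

/-- Quantile transform: the quantile function has the law of the random variable. -/
theorem map_VaR (hZ : Measurable Z) :
    (volume.restrict (Ioo (0 : ℝ) 1)).map (VaR μ Z) = μ.map Z := by
  have hm : AEMeasurable (VaR μ Z) (volume.restrict (Ioo (0 : ℝ) 1)) :=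
    aemeasurable_restrict_of_monotoneOn measurableSet_Ioo (monotoneOn_VaR hZ)
  have : IsFiniteMeasure (volume.restrict (Ioo (0 : ℝ) 1)) := ⟨by simp⟩
  refine Measure.ext_of_Iic _ _ fun x => ?_
  rw [Measure.map_apply_of_aemeasurable hm measurableSet_Iic, Measure.map_apply hZ measurableSet_Iic]
  have h0 : (0 : ℝ) ≤ μ.real {ω | Z ω ≤ x} := measureReal_nonneg
  have h1 : μ.real {ω | Z ω ≤ x} ≤ 1 := measureReal_le_one
  have h2 : μ (Z ⁻¹' Iic x) = ENNReal.ofReal (μ.real {ω | Z ω ≤ x}) :=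
    (ofReal_measureReal (measure_ne_top _ _)).symm
  rw [h2, Measure.restrict_apply' measurableSet_Ioo]
  set c := μ.real {ω | Z ω ≤ x} with hc
  -- Within `(0, 1)` this sublevel set is an initial segment ending at the value of the distribution
  -- function at `x`, which is therefore its length.
  have h3 : VaR μ Z ⁻¹' Iic x ∩ Ioo 0 1 = Iic c ∩ Ioo 0 1 := by
    ext u
    simp only [mem_inter_iff, mem_preimage, mem_Iic, and_congr_left_iff]
    exact fun hu => VaR_le_iff hZ hu.1 hu.2
  rw [h3]
  apply le_antisymm
  · refine (measure_mono (t := Ioc 0 c) fun u hu => ⟨hu.2.1, hu.1⟩).trans ?_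
    simp
  · refine le_trans ?_ (measure_mono (s := Ioo 0 c) fun u hu => ⟨hu.2.le, hu.1, hu.2.trans_le h1⟩)
    simp

end ValueAtRisk

/-- The objective of Rockafellar and Uryasev, whose minimum over `l` is the `CVaR`. -/
def ruObjective {Ω : Type*} [MeasurableSpace Ω] (μ : Measure Ω) (Z : Ω → ℝ) (α l : ℝ) : ℝ :=
  l + (1 / (1 - α)) * ∫ ω, max (Z ω - l) 0 ∂μ

/-! ### CVaR through the Rockafellar-Uryasev objective -/

section ValueAtRisk

open Set

variable {Ω : Type*} [MeasurableSpace Ω] {μ : Measure Ω} [IsProbabilityMeasure μ] {Z : Ω → ℝ}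
  {α : ℝ}

theorem integrable_posPart_sub (hZi : Integrable Z μ) (l : ℝ) :
    Integrable (fun ω => max (Z ω - l) 0) μ :=
  (hZi.sub (integrable_const l)).pos_part

/-- The quantile transform moves the expected excess over `q` to an integral over `(0, 1)`. By
monotonicity `VaR_u - q` is at most zero for `u ≤ α` and at least zero beyond, so the positive part
just cuts the integral down to `(α, 1)`. -/
theorem CVaR_eq_ruObjective_VaR (hZ : Measurable Z) (hZi : Integrable Z μ) (hα0 : 0 < α)
    (hα1 : α < 1) : CVaR μ Z α = ruObjective μ Z α (VaR μ Z α) := by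
  set q := VaR μ Z α with hq
  have hm : AEMeasurable (VaR μ Z) (volume.restrict (Ioo (0 : ℝ) 1)) :=
    aemeasurable_restrict_of_monotoneOn measurableSet_Ioo (monotoneOn_VaR hZ)
  have hcont : Continuous fun x : ℝ => max (x - q) 0 := by fun_prop
  have h1 : ∫ ω, max (Z ω - q) 0 ∂μ = ∫ u in Ioo 0 1, max (VaR μ Z u - q) 0 := by
    rw [← integral_map (f := fun x : ℝ => max (x - q) 0) hZ.aemeasurable
      hcont.aestronglyMeasurable, ← map_VaR hZ,
      integral_map hm hcont.aestronglyMeasurable]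
  have hi : IntegrableOn (fun u => max (VaR μ Z u - q) 0) (Ioo 0 1) := by
    have h2 : Integrable (fun x : ℝ => max (x - q) 0) (μ.map Z) :=
      (integrable_map_measure hcont.aestronglyMeasurable hZ.aemeasurable).2
        (integrable_posPart_sub hZi q)
    rw [← map_VaR hZ, integrable_map_measure hcont.aestronglyMeasurable hm] at h2
    exact h2
  have hsub : Ioo α 1 ⊆ Ioo 0 1 := Ioo_subset_Ioo_left hα0.le
  have h3 : ∫ u in Ioo 0 1, max (VaR μ Z u - q) 0 = ∫ u in Ioo α 1, max (VaR μ Z u - q) 0 := by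
    refine setIntegral_eq_of_subset_of_forall_sdiff_eq_zero measurableSet_Ioo hsub ?_
    intro u hu
    have h4 : u ≤ α := by
      by_contra! h
      exact hu.2 ⟨h, hu.1.2⟩
    have := monotoneOn_VaR (μ := μ) hZ hu.1 ⟨hα0, hα1⟩ h4
    exact max_eq_right (by linarith)
  have h5 : ∫ u in α..1, VaR μ Z u = ∫ u in Ioo α 1, (max (VaR μ Z u - q) 0 + q) := by
    rw [intervalIntegral.integral_of_le hα1.le, integral_Ioc_eq_integral_Ioo]
    refine setIntegral_congr_fun measurableSet_Ioo fun u hu => ?_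
    have := monotoneOn_VaR (μ := μ) hZ ⟨hα0, hα1⟩ (hsub hu) hu.1.le
    rw [max_eq_left (by linarith)]
    ring
  have h6 : (0 : ℝ) < 1 - α := by linarith
  have h7 : IntegrableOn (fun _ : ℝ => q) (Ioo α 1) := integrableOn_const (by simp)
  rw [CVaR, ruObjective, h5, integral_add (hi.mono_set hsub) h7, h1, h3, setIntegral_const,
    Real.volume_real_Ioo_of_le hα1.le, smul_eq_mul]
  field_simp
  ring

end ValueAtRisk

/-! ### Extremal densities and complementarity -/

section Density

open Set

variable {Ω : Type*} {Z : Ω → ℝ} {α : ℝ} {ξ : Ω → ℝ} {l : ℝ}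

/-- The density that maximises the Lagrangian and vanishes wherever it may. -/
def lowerDensity (Z : Ω → ℝ) (α l : ℝ) : Ω → ℝ := {ω | l < Z ω}.indicator fun _ => 1 / (1 - α)

/-- The density that maximises the Lagrangian and is maximal wherever it may be. -/
def upperDensity (Z : Ω → ℝ) (α l : ℝ) : Ω → ℝ := {ω | l ≤ Z ω}.indicator fun _ => 1 / (1 - α)

theorem lowerDensity_le_upperDensity (hα1 : α < 1) (Z : Ω → ℝ) (l : ℝ) (ω : Ω) :
    lowerDensity Z α l ω ≤ upperDensity Z α l ω := by
  have hM : 0 ≤ 1 / (1 - α) := by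
    have : 0 < 1 - α := by linarith
    positivity
  exact indicator_le_indicator_of_subset (fun _ (h : l < Z _) => h.le) (fun _ => hM) ω

theorem lowerDensity_nonneg (hα1 : α < 1) (Z : Ω → ℝ) (l : ℝ) (ω : Ω) :
    0 ≤ lowerDensity Z α l ω := by
  have : 0 < 1 - α := by linarith
  exact indicator_nonneg (fun _ _ => by positivity) ω

theorem upperDensity_le (hα1 : α < 1) (Z : Ω → ℝ) (l : ℝ) (ω : Ω) :
    upperDensity Z α l ω ≤ 1 / (1 - α) := by
  have : 0 < 1 - α := by linarith
  exact indicator_le_self' (fun _ _ => by positivity) ω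

/-- The two extremal densities agree off `{Z = l}`, and on that set both sides vanish. Together with
`between_of_mul_eq`, this turns complementarity into an order condition. -/
theorem mul_eq_of_between {ω : Ω} (h1 : lowerDensity Z α l ω ≤ ξ ω)
    (h2 : ξ ω ≤ upperDensity Z α l ω) :
    (Z ω - l) * ξ ω = 1 / (1 - α) * max (Z ω - l) 0 := by
  rw [lowerDensity, indicator_apply] at h1
  rw [upperDensity, indicator_apply] at h2
  simp only [mem_ofPred_eq] at h1 h2
  rcases lt_trichotomy l (Z ω) with h | h | h
  · rw [if_pos h] at h1
    rw [if_pos h.le] at h2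
    rw [le_antisymm h2 h1, max_eq_left (by linarith), mul_comm]
  · simp [h]
  · rw [if_neg (by linarith)] at h1
    rw [if_neg (by linarith)] at h2
    rw [le_antisymm h2 h1, max_eq_right (by linarith), mul_zero, mul_zero]

theorem between_of_mul_eq {ω : Ω} (h0 : 0 ≤ ξ ω ∧ ξ ω ≤ 1 / (1 - α))
    (h : (Z ω - l) * ξ ω = 1 / (1 - α) * max (Z ω - l) 0) :
    lowerDensity Z α l ω ≤ ξ ω ∧ ξ ω ≤ upperDensity Z α l ω := by
  rw [lowerDensity, upperDensity, indicator_apply, indicator_apply]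
  simp only [mem_ofPred_eq]
  rcases lt_trichotomy l (Z ω) with h' | h' | h'
  · rw [max_eq_left (by linarith), mul_comm] at h
    have := mul_right_cancel₀ (sub_ne_zero.2 h'.ne') h
    rw [if_pos h', if_pos h'.le, this]
    exact ⟨le_rfl, le_rfl⟩
  · rw [if_neg (by linarith), if_pos h'.le]
    exact h0
  · rw [max_eq_right (by linarith), mul_zero] at h
    have := (mul_eq_zero.1 h).resolve_left (sub_ne_zero.2 h'.ne)
    rw [if_neg (by linarith), if_neg (by linarith), this]
    exact ⟨le_rfl, le_rfl⟩

end Density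

/-! ### Lagrangian duality for CVaR -/

section Duality

open Set

variable {Ω : Type*} [MeasurableSpace Ω] {μ : Measure Ω} {Z : Ω → ℝ} {α : ℝ} {ξ : Ω → ℝ} {l : ℝ}

theorem IsBoxed.integrable_smul {E : Type*} [NormedAddCommGroup E] [NormedSpace ℝ E] {f : Ω → E}
    (hξ : IsBoxed μ α ξ) (hf : Integrable f μ) : Integrable (fun ω => ξ ω • f ω) μ := by
  refine Integrable.bdd_smul (C := 1 / (1 - α)) hf hξ.1.aestronglyMeasurable ?_
  filter_upwards [hξ.2] with ω h
  rw [Real.norm_eq_abs, abs_of_nonneg h.1]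
  exact h.2

theorem IsBoxed.integrable_mul {f : Ω → ℝ} (hξ : IsBoxed μ α ξ) (hf : Integrable f μ) :
    Integrable (fun ω => f ω * ξ ω) μ := by
  simpa only [smul_eq_mul, mul_comm] using hξ.integrable_smul hf

theorem IsBoxed.norm_integral_smul_le {E : Type*} [NormedAddCommGroup E] [NormedSpace ℝ E]
    {f : Ω → E} (hξ : IsBoxed μ α ξ) (hf : Integrable f μ) :
    ‖∫ ω, ξ ω • f ω ∂μ‖ ≤ 1 / (1 - α) * ∫ ω, ‖f ω‖ ∂μ := by
  rw [← integral_const_mul]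
  refine norm_integral_le_of_norm_le (hf.norm.const_mul _) ?_
  filter_upwards [hξ.2] with ω h
  rw [norm_smul, Real.norm_eq_abs, abs_of_nonneg h.1]
  exact mul_le_mul_of_nonneg_right h.2 (norm_nonneg _)

theorem IsBoxed.ae_mul_le (hξ : IsBoxed μ α ξ) (Z : Ω → ℝ) (l : ℝ) :
    ∀ᵐ ω ∂μ, (Z ω - l) * ξ ω ≤ 1 / (1 - α) * max (Z ω - l) 0 := by
  filter_upwards [hξ.2] with ω h
  calc (Z ω - l) * ξ ω ≤ max (Z ω - l) 0 * ξ ω :=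
        mul_le_mul_of_nonneg_right (le_max_left _ _) h.1
    _ ≤ max (Z ω - l) 0 * (1 / (1 - α)) := mul_le_mul_of_nonneg_left h.2 (le_max_right _ _)
    _ = _ := mul_comm _ _

theorem isBoxed_of_forall (hξ : Measurable ξ) (h : ∀ ω, 0 ≤ ξ ω ∧ ξ ω ≤ 1 / (1 - α)) :
    IsBoxed μ α ξ := ⟨hξ.aemeasurable, Eventually.of_forall h⟩

theorem measurable_lowerDensity (hZ : Measurable Z) : Measurable (lowerDensity Z α l) :=
  measurable_const.indicator (measurableSet_lt measurable_const hZ)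

theorem measurable_upperDensity (hZ : Measurable Z) : Measurable (upperDensity Z α l) :=
  measurable_const.indicator (measurableSet_le measurable_const hZ)

theorem isBoxed_of_between (hα1 : α < 1) (hξ : Measurable ξ) (h1 : ∀ ω, lowerDensity Z α l ω ≤ ξ ω)
    (h2 : ∀ ω, ξ ω ≤ upperDensity Z α l ω) : IsBoxed μ α ξ :=
  isBoxed_of_forall hξ fun ω => ⟨(lowerDensity_nonneg hα1 Z l ω).trans (h1 ω),
    (h2 ω).trans (upperDensity_le hα1 Z l ω)⟩

variable [IsProbabilityMeasure μ]

theorem IsBoxed.integrable (hξ : IsBoxed μ α ξ) : Integrable ξ μ := by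
  simpa using hξ.integrable_mul (integrable_const (1 : ℝ))

theorem integral_sub_const_mul (hZi : Integrable Z μ) (hξ : IsBoxed μ α ξ) (l : ℝ) :
    ∫ ω, (Z ω - l) * ξ ω ∂μ = ∫ ω, Z ω * ξ ω ∂μ - l * ∫ ω, ξ ω ∂μ := by
  rw [← integral_const_mul, ← integral_sub (hξ.integrable_mul hZi) (hξ.integrable.const_mul l)]
  simp only [sub_mul]

theorem lagrangian_eq (hZi : Integrable Z μ) (hξ : IsBoxed μ α ξ) (l : ℝ) :
    lagrangian μ Z ξ l = l + ∫ ω, (Z ω - l) * ξ ω ∂μ := by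
  rw [lagrangian, integral_sub_const_mul hZi hξ]
  ring

theorem IsBoxed.lagrangian_le (hξ : IsBoxed μ α ξ) (hZi : Integrable Z μ) (l : ℝ) :
    lagrangian μ Z ξ l ≤ ruObjective μ Z α l := by
  rw [lagrangian_eq hZi hξ, ruObjective, ← integral_const_mul]
  refine add_le_add_right ?_ _
  exact integral_mono_ae (hξ.integrable_mul (hZi.sub (integrable_const l)))
    ((integrable_posPart_sub hZi l).const_mul _) (hξ.ae_mul_le Z l)

/-- The two integrals are `P(Z > l)/(1-α)` and `P(Z ≥ l)/(1-α)`. In this form, being a quantile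
means that mean one is attainable between the extremal densities. -/
theorem isQuantile_iff (hZ : Measurable Z) (hα1 : α < 1) : IsQuantile μ Z α l ↔
    ∫ ω, lowerDensity Z α l ω ∂μ ≤ 1 ∧ 1 ≤ ∫ ω, upperDensity Z α l ω ∂μ := by
  have h0 : 0 < 1 - α := by linarith
  have h1 : {ω | l < Z ω} = {ω | Z ω ≤ l}ᶜ := by ext; simp
  have h2 : {ω | l ≤ Z ω} = {ω | Z ω < l}ᶜ := by ext; simp
  have m1 : MeasurableSet {ω | Z ω ≤ l} := measurableSet_le hZ measurable_const
  have m2 : MeasurableSet {ω | Z ω < l} := measurableSet_lt hZ measurable_const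
  unfold lowerDensity upperDensity
  rw [h1, h2, integral_indicator_const _ m1.compl, integral_indicator_const _ m2.compl,
    probReal_compl_eq_one_sub m1, probReal_compl_eq_one_sub m2, smul_eq_mul, smul_eq_mul,
    mul_one_div, mul_one_div, div_le_one h0, one_le_div h0, IsQuantile, and_comm]
  constructor <;> rintro ⟨h, h'⟩ <;> constructor <;> linarith

theorem IsBoxed.ae_mul_eq (hξ : IsBoxed μ α ξ) (hZi : Integrable Z μ)
    (h : ruObjective μ Z α l ≤ lagrangian μ Z ξ l) :
    ∀ᵐ ω ∂μ, (Z ω - l) * ξ ω = 1 / (1 - α) * max (Z ω - l) 0 := by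
  rw [lagrangian_eq hZi hξ, ruObjective, ← integral_const_mul] at h
  have i1 := hξ.integrable_mul (hZi.sub (integrable_const l))
  have i2 := (integrable_posPart_sub hZi l).const_mul (1 / (1 - α))
  refine (integral_eq_iff_of_ae_le i1 i2 (hξ.ae_mul_le Z l)).1 (le_antisymm ?_ ?_)
  · exact integral_mono_ae i1 i2 (hξ.ae_mul_le Z l)
  · exact (add_le_add_iff_left _).1 h

theorem IsBoxed.isQuantile (hξ : IsBoxed μ α ξ) (hZ : Measurable Z) (hα1 : α < 1)
    (h1 : ∫ ω, ξ ω ∂μ = 1)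
    (h : ∀ᵐ ω ∂μ, (Z ω - l) * ξ ω = 1 / (1 - α) * max (Z ω - l) 0) : IsQuantile μ Z α l := by
  have hb : ∀ᵐ ω ∂μ, lowerDensity Z α l ω ≤ ξ ω ∧ ξ ω ≤ upperDensity Z α l ω := by
    filter_upwards [h, hξ.2] with ω h h' using between_of_mul_eq h' h
  rw [isQuantile_iff hZ hα1, ← h1]
  have b1 : IsBoxed μ α (lowerDensity Z α l) := isBoxed_of_between hα1 (measurable_lowerDensity hZ)
    (fun _ => le_rfl) (lowerDensity_le_upperDensity hα1 Z l)
  have b2 : IsBoxed μ α (upperDensity Z α l) := isBoxed_of_between hα1 (measurable_upperDensity hZ)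
    (lowerDensity_le_upperDensity hα1 Z l) (fun _ => le_rfl)
  exact ⟨integral_mono_ae b1.integrable hξ.integrable (hb.mono fun _ h => h.1),
    integral_mono_ae hξ.integrable b2.integrable (hb.mono fun _ h => h.2)⟩

theorem IsBoxed.lagrangian_eq_ruObjective (hξ : IsBoxed μ α ξ) (hZi : Integrable Z μ)
    (h : ∀ᵐ ω ∂μ, (Z ω - l) * ξ ω = 1 / (1 - α) * max (Z ω - l) 0) :
    lagrangian μ Z ξ l = ruObjective μ Z α l := by
  rw [lagrangian_eq hZi hξ, ruObjective, ← integral_const_mul, integral_congr_ae h]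

/-- The Lagrangian is affine in the multiplier, so a minimum exists only if the slope `1 - E[ξ]` is
zero. Maximality in `ξ` means attaining the bound `ruObjective`, which forces pointwise equality
almost surely. -/
theorem isSaddlePoint_iff (hZ : Measurable Z) (hZi : Integrable Z μ) (hα1 : α < 1) :
    IsSaddlePoint μ Z α ξ l ↔ IsBoxed μ α ξ ∧ ∫ ω, ξ ω ∂μ = 1 ∧
      ∀ᵐ ω ∂μ, (Z ω - l) * ξ ω = 1 / (1 - α) * max (Z ω - l) 0 := by
  constructor
  · rintro ⟨hξ, h1, h2⟩
    refine ⟨hξ, ?_, hξ.ae_mul_eq hZi ?_⟩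
    · have h3 := h2 (l + (∫ ω, ξ ω ∂μ - 1))
      unfold lagrangian at h3
      nlinarith [sq_nonneg (∫ ω, ξ ω ∂μ - 1)]
    · have b1 : IsBoxed μ α (lowerDensity Z α l) :=
        isBoxed_of_between hα1 (measurable_lowerDensity hZ) (fun _ => le_rfl)
          (lowerDensity_le_upperDensity hα1 Z l)
      rw [← b1.lagrangian_eq_ruObjective hZi (Eventually.of_forall fun ω => mul_eq_of_between le_rfl
        (lowerDensity_le_upperDensity hα1 Z l ω))]
      exact h1 _ b1
  · rintro ⟨hξ, h1, h2⟩
    refine ⟨hξ, fun η hη => ?_, fun m => ?_⟩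
    · rw [hξ.lagrangian_eq_ruObjective hZi h2]
      exact hη.lagrangian_le hZi l
    · simp [lagrangian, h1]

/-- Near every density with values in `[0, 1/(1-α)]` which almost maximises the Lagrangian and
almost has integral one, there is a saddle-point. -/
theorem exists_isSaddlePoint_near (hZ : Measurable Z) (hZi : Integrable Z μ) (hα1 : α < 1)
    (hl : IsQuantile μ Z α l) (hξ : Measurable ξ) (hξb : IsBoxed μ α ξ) :
    ∃ ζ : Ω → ℝ, Measurable ζ ∧ (∀ ω, 0 ≤ ζ ω ∧ ζ ω ≤ 1 / (1 - α)) ∧ IsSaddlePoint μ Z α ζ l ∧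
      ∫ ω, |ζ ω - ξ ω| ∂μ ≤ 2 * ∫ ω, {ω | Z ω ≠ l}.indicator (fun ω => |lowerDensity Z α l ω - ξ ω|) ω ∂μ
        + |∫ ω, ξ ω ∂μ - 1| := by
  set lo := lowerDensity Z α l with hlo
  set up := upperDensity Z α l with hup
  have mlo : Measurable lo := measurable_lowerDensity hZ
  have mup : Measurable up := measurable_upperDensity hZ
  have hle : ∀ ω, lo ω ≤ up ω := lowerDensity_le_upperDensity hα1 Z l
  -- Clamping between the extremal densities enforces complementarity and changes nothing where `Z =
  -- l`.
  set ξ₀ : Ω → ℝ := fun ω => max (lo ω) (min (ξ ω) (up ω)) with hξ₀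
  have m₀ : Measurable ξ₀ := mlo.max (hξ.min mup)
  have lo₀ : ∀ ω, lo ω ≤ ξ₀ ω := fun ω => le_max_left _ _
  have up₀ : ∀ ω, ξ₀ ω ≤ up ω := fun ω => max_le (hle ω) (min_le_right _ _)
  have b₀ : IsBoxed μ α ξ₀ := isBoxed_of_between hα1 m₀ lo₀ up₀
  -- The mean is corrected by moving from `ξ₀` a fraction `r` of the way to the upper density if the
  -- mean is too small, to the lower one if it is too large. The move has constant sign, so its `L¹`
  -- norm is the absolute change of the mean.
  have key : ∃ u : Ω → ℝ, Measurable u ∧ (∀ ω, lo ω ≤ u ω) ∧ (∀ ω, u ω ≤ up ω) ∧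
      ∃ r : ℝ, 0 ≤ r ∧ r ≤ 1 ∧ ∫ ω, ξ₀ ω ∂μ + r * (∫ ω, u ω ∂μ - ∫ ω, ξ₀ ω ∂μ) = 1 ∧
      ∫ ω, |u ω - ξ₀ ω| ∂μ = |∫ ω, u ω ∂μ - ∫ ω, ξ₀ ω ∂μ| := by
    obtain ⟨q1, q2⟩ := (isQuantile_iff hZ hα1).1 hl
    have interp : ∀ a b : ℝ, (a ≤ 1 ∧ 1 ≤ b ∨ b ≤ 1 ∧ 1 ≤ a) →
        ∃ r : ℝ, 0 ≤ r ∧ r ≤ 1 ∧ a + r * (b - a) = 1 := by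
      intro a b hab
      rcases eq_or_ne a b with rfl | hne
      · exact ⟨0, le_rfl, zero_le_one, by rcases hab with h | h <;> linarith⟩
      · have hne' : b - a ≠ 0 := sub_ne_zero.2 hne.symm
        refine ⟨(1 - a) / (b - a), ?_, ?_, by field_simp; ring⟩
        · rcases hab with h | h
          · exact div_nonneg (by linarith) (by linarith)
          · exact div_nonneg_of_nonpos (by linarith) (by linarith)
        · rcases hab with h | h
          · exact div_le_one_of_le₀ (by linarith) (by linarith)
          · exact div_le_one_of_ge (by linarith) (by linarith)
    have blo : IsBoxed μ α lo := isBoxed_of_between hα1 mlo (fun _ => le_rfl) hle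
    have bup : IsBoxed μ α up := isBoxed_of_between hα1 mup hle (fun _ => le_rfl)
    rcases le_total (∫ ω, ξ₀ ω ∂μ) 1 with h | h
    · obtain ⟨r, r0, r1, hr⟩ := interp (∫ ω, ξ₀ ω ∂μ) (∫ ω, up ω ∂μ) (Or.inl ⟨h, q2⟩)
      refine ⟨up, mup, hle, fun _ => le_rfl, r, r0, r1, hr, ?_⟩
      rw [abs_of_nonneg (by linarith), ← integral_sub bup.integrable b₀.integrable]
      exact integral_congr_ae (Eventually.of_forall fun ω => abs_of_nonneg (sub_nonneg.2 (up₀ ω)))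
    · obtain ⟨r, r0, r1, hr⟩ := interp (∫ ω, ξ₀ ω ∂μ) (∫ ω, lo ω ∂μ) (Or.inr ⟨q1, h⟩)
      refine ⟨lo, mlo, fun _ => le_rfl, hle, r, r0, r1, hr, ?_⟩
      rw [abs_of_nonpos (by linarith), ← integral_sub blo.integrable b₀.integrable, ← integral_neg]
      exact integral_congr_ae (Eventually.of_forall fun ω => abs_of_nonpos (sub_nonpos.2 (lo₀ ω)))
  obtain ⟨u, mu, lou, upu, r, r0, r1, hr, hu⟩ := key
  have bu : IsBoxed μ α u := isBoxed_of_between hα1 mu lou upu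
  set ζ : Ω → ℝ := fun ω => ξ₀ ω + r * (u ω - ξ₀ ω) with hζ
  have mζ : Measurable ζ := m₀.add ((mu.sub m₀).const_mul r)
  have loζ : ∀ ω, lo ω ≤ ζ ω := fun ω => by
    have := lo₀ ω; have := lou ω
    simp only [hζ]; nlinarith
  have upζ : ∀ ω, ζ ω ≤ up ω := fun ω => by
    have := up₀ ω; have := upu ω
    simp only [hζ]; nlinarith
  have bζ : IsBoxed μ α ζ := isBoxed_of_between hα1 mζ loζ upζ
  have iu := bu.integrable
  have i₀ := b₀.integrable
  have iζ := bζ.integrable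
  have iξ := hξb.integrable
  refine ⟨ζ, mζ, fun ω => ⟨(lowerDensity_nonneg hα1 Z l ω).trans (loζ ω),
    (upζ ω).trans (upperDensity_le hα1 Z l ω)⟩, (isSaddlePoint_iff hZ hZi hα1).2 ⟨bζ, ?_, ?_⟩, ?_⟩
  · have i4 : Integrable (fun ω => r * (u ω - ξ₀ ω)) μ := (iu.sub i₀).const_mul r
    simp only [hζ]
    rw [integral_add i₀ i4, integral_const_mul, integral_sub iu i₀]
    exact hr
  · exact Eventually.of_forall fun ω => mul_eq_of_between (loζ ω) (upζ ω)
  · have e1 : ∫ ω, |ζ ω - ξ₀ ω| ∂μ = |∫ ω, ξ₀ ω ∂μ - 1| := by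
      have : ∀ ω, |ζ ω - ξ₀ ω| = r * |u ω - ξ₀ ω| := fun ω => by
        simp only [hζ]
        rw [add_sub_cancel_left, abs_mul, abs_of_nonneg r0]
      simp only [this]
      rw [integral_const_mul, hu, abs_sub_comm _ 1, ← eq_sub_iff_add_eq'.2 hr, abs_mul, abs_of_nonneg r0]
    have e2 : ∀ᵐ ω ∂μ, |ξ₀ ω - ξ ω| ≤ {ω | Z ω ≠ l}.indicator (fun ω => |lo ω - ξ ω|) ω := by
      filter_upwards [hξb.2] with ω h
      rw [indicator_apply]
      simp only [mem_ofPred_eq, hξ₀, hlo, hup, lowerDensity, upperDensity, indicator_apply]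
      rcases lt_trichotomy l (Z ω) with h' | h' | h'
      · simp [h', h'.le, h'.ne']
      · have h2 := h.2
        rw [if_neg h'.not_lt, if_pos h'.le, if_neg (by simp [h']), min_eq_left h2, max_eq_right h.1,
          sub_self, abs_zero]
      · simp [h'.not_ge, h'.not_gt, h'.ne, h.1]
    have i3 : Integrable ({ω | Z ω ≠ l}.indicator fun ω => |lo ω - ξ ω|) μ := by
      refine Integrable.indicator ?_ (hZ (measurableSet_singleton l).compl)
      exact ((isBoxed_of_between hα1 mlo (fun _ => le_rfl) hle).integrable.sub iξ).abs
    have e3 := integral_mono_ae (i₀.sub iξ).abs i3 e2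
    have e4 : ∫ ω, |ζ ω - ξ ω| ∂μ ≤ ∫ ω, |ζ ω - ξ₀ ω| ∂μ + ∫ ω, |ξ₀ ω - ξ ω| ∂μ := by
      have j1 : Integrable (fun ω => |ζ ω - ξ₀ ω|) μ := (iζ.sub i₀).abs
      have j2 : Integrable (fun ω => |ξ₀ ω - ξ ω|) μ := (i₀.sub iξ).abs
      rw [← integral_add j1 j2]
      exact integral_mono (iζ.sub iξ).abs (j1.add j2) fun ω => abs_sub_le _ _ _
    have e5 : |∫ ω, ξ₀ ω ∂μ - 1| ≤ ∫ ω, |ξ₀ ω - ξ ω| ∂μ + |∫ ω, ξ ω ∂μ - 1| := by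
      refine (abs_sub_le _ (∫ ω, ξ ω ∂μ) _).trans (add_le_add_left ?_ _)
      rw [← integral_sub i₀ iξ]
      exact abs_integral_le_integral_abs
    simp only [Pi.sub_apply] at e3
    linarith

theorem exists_isSaddlePoint (hZ : Measurable Z) (hZi : Integrable Z μ) (hα1 : α < 1)
    (hl : IsQuantile μ Z α l) :
    ∃ ζ : Ω → ℝ, Measurable ζ ∧ (∀ ω, 0 ≤ ζ ω ∧ ζ ω ≤ 1 / (1 - α)) ∧ IsSaddlePoint μ Z α ζ l := by
  obtain ⟨ζ, h1, h2, h3, -⟩ := exists_isSaddlePoint_near hZ hZi hα1 hl (measurable_lowerDensity hZ)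
    (isBoxed_of_between hα1 (measurable_lowerDensity hZ) (fun _ => le_rfl)
      (lowerDensity_le_upperDensity hα1 Z l))
  exact ⟨ζ, h1, h2, h3⟩

theorem IsSaddlePoint.integral_eq_one (h : IsSaddlePoint μ Z α ξ l) (hZ : Measurable Z)
    (hZi : Integrable Z μ) (hα1 : α < 1) : ∫ ω, ξ ω ∂μ = 1 :=
  ((isSaddlePoint_iff hZ hZi hα1).1 h).2.1

theorem IsSaddlePoint.isQuantile (h : IsSaddlePoint μ Z α ξ l) (hZ : Measurable Z)
    (hZi : Integrable Z μ) (hα1 : α < 1) : IsQuantile μ Z α l := by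
  obtain ⟨h0, h1, h2⟩ := (isSaddlePoint_iff hZ hZi hα1).1 h
  exact h0.isQuantile hZ hα1 h1 h2

theorem IsSaddlePoint.ruObjective_eq (h : IsSaddlePoint μ Z α ξ l) (hZ : Measurable Z)
    (hZi : Integrable Z μ) (hα1 : α < 1) : ruObjective μ Z α l = ∫ ω, Z ω * ξ ω ∂μ := by
  obtain ⟨h0, h1, h2⟩ := (isSaddlePoint_iff hZ hZi hα1).1 h
  rw [← h0.lagrangian_eq_ruObjective hZi h2, lagrangian, h1]
  ring

theorem IsBoxed.integral_mul_le (hξ : IsBoxed μ α ξ) (hZi : Integrable Z μ)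
    (h1 : ∫ ω, ξ ω ∂μ = 1) (m : ℝ) : ∫ ω, Z ω * ξ ω ∂μ ≤ ruObjective μ Z α m := by
  refine le_trans (le_of_eq ?_) (hξ.lagrangian_le hZi m)
  rw [lagrangian, h1]
  ring

/-- The formula is known for saddle-points at the VaR. Two saddle-points have the same value: each
density has mean one, so weak duality bounds its value by the objective at the other's multiplier.
-/
theorem IsSaddlePoint.CVaR_eq (h : IsSaddlePoint μ Z α ξ l) (hZ : Measurable Z)
    (hZi : Integrable Z μ) (hα0 : 0 < α) (hα1 : α < 1) : CVaR μ Z α = ∫ ω, Z ω * ξ ω ∂μ := by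
  obtain ⟨ζ, -, -, hζ⟩ := exists_isSaddlePoint hZ hZi hα1 (isQuantile_VaR hZ hα0 hα1)
  rw [CVaR_eq_ruObjective_VaR hZ hZi hα0 hα1]
  apply le_antisymm
  · rw [hζ.ruObjective_eq hZ hZi hα1, ← h.ruObjective_eq hZ hZi hα1]
    exact hζ.1.integral_mul_le hZi (hζ.integral_eq_one hZ hZi hα1) _
  · exact h.1.integral_mul_le hZi (h.integral_eq_one hZ hZi hα1) _

theorem IsQuantile.CVaR_eq (hl : IsQuantile μ Z α l) (hZ : Measurable Z)
    (hZi : Integrable Z μ) (hα0 : 0 < α) (hα1 : α < 1) : CVaR μ Z α = ruObjective μ Z α l := by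
  obtain ⟨ζ, -, -, hζ⟩ := exists_isSaddlePoint hZ hZi hα1 hl
  rw [hζ.CVaR_eq hZ hZi hα0 hα1, hζ.ruObjective_eq hZ hZi hα1]

theorem CVaR_le_ruObjective (hZ : Measurable Z) (hZi : Integrable Z μ) (hα0 : 0 < α) (hα1 : α < 1)
    (m : ℝ) : CVaR μ Z α ≤ ruObjective μ Z α m := by
  obtain ⟨ζ, -, -, hζ⟩ := exists_isSaddlePoint hZ hZi hα1 (isQuantile_VaR hZ hα0 hα1)
  rw [hζ.CVaR_eq hZ hZi hα0 hα1]
  exact hζ.1.integral_mul_le hZi (hζ.integral_eq_one hZ hZi hα1) _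

/-- A minimiser of the objective of Rockafellar and Uryasev is a quantile. -/
theorem isQuantile_of_ruObjective_le (hZ : Measurable Z) (hZi : Integrable Z μ) (hα0 : 0 < α)
    (hα1 : α < 1) (h : ruObjective μ Z α l ≤ CVaR μ Z α) : IsQuantile μ Z α l := by
  obtain ⟨ζ, -, -, hζ⟩ := exists_isSaddlePoint hZ hZi hα1 (isQuantile_VaR hZ hα0 hα1)
  have h1 := hζ.integral_eq_one hZ hZi hα1
  -- A saddle-point density at the VaR has mean one, so its Lagrangian equals CVaR at every
  -- multiplier. It therefore attains the bound at `l` also, and complementarity at `l` gives the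
  -- quantile property.
  refine hζ.1.isQuantile hZ hα1 h1 (hζ.1.ae_mul_eq hZi (h.trans (le_of_eq ?_)))
  rw [hζ.CVaR_eq hZ hZi hα0 hα1, lagrangian, h1]
  ring

theorem abs_CVaR_le (hZ : Measurable Z) (hZi : Integrable Z μ) (hα0 : 0 < α) (hα1 : α < 1) :
    |CVaR μ Z α| ≤ 1 / (1 - α) * ∫ ω, |Z ω| ∂μ := by
  obtain ⟨ζ, -, -, hζ⟩ := exists_isSaddlePoint hZ hZi hα1 (isQuantile_VaR hZ hα0 hα1)
  rw [hζ.CVaR_eq hZ hZi hα0 hα1]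
  simpa only [smul_eq_mul, mul_comm, Real.norm_eq_abs] using hζ.1.norm_integral_smul_le hZi

end Duality

/-! ### Change of weight, and differentiation under the integral -/

section Auxiliary

open Set

variable {Ω : Type*} [MeasurableSpace Ω] {μ : Measure Ω}

/-- If the uniformly bounded functions `f i` tend to zero in the mean with respect to the weight
`h`, then so they do with respect to every integrable weight supported where `h` is positive. -/
theorem tendsto_integral_mul_zero {ι : Type*} {L : Filter ι} {f : ι → Ω → ℝ} {g h : Ω → ℝ} {M : ℝ}
    (hh : Integrable h μ) (hg : Integrable g μ) (h0 : ∀ ω, 0 ≤ h ω) (g0 : ∀ ω, 0 ≤ g ω)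
    (hgh : ∀ ω, h ω = 0 → g ω = 0) (hf : ∀ i, Measurable (f i))
    (hfM : ∀ i ω, 0 ≤ f i ω ∧ f i ω ≤ M) (hlim : Tendsto (fun i => ∫ ω, h ω * f i ω ∂μ) L (𝓝 0)) :
    Tendsto (fun i => ∫ ω, g ω * f i ω ∂μ) L (𝓝 0) := by
  have int : ∀ {k : Ω → ℝ}, Integrable k μ → ∀ i, Integrable (fun ω => k ω * f i ω) μ :=
    fun hk i => hk.mul_bdd (c := M) (hf i).aestronglyMeasurable
      (Eventually.of_forall fun ω => by
        rw [Real.norm_eq_abs, abs_of_nonneg (hfM i ω).1]; exact (hfM i ω).2)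
  have ik : ∀ n : ℕ, Integrable (fun ω => max (g ω - n * h ω) 0) μ := fun n =>
    (hg.sub (hh.const_mul _)).pos_part
  -- The excess of `g` over `n * h` is dominated by `g` and is eventually zero at each point,
  -- because `g` vanishes wherever `h` does.
  have h1 : Tendsto (fun n : ℕ => ∫ ω, max (g ω - n * h ω) 0 ∂μ) atTop (𝓝 (∫ _, 0 ∂μ)) := by
    refine tendsto_integral_of_dominated_convergence g (fun n => (ik n).aestronglyMeasurable) hg
      (fun n => Eventually.of_forall fun ω => ?_) (Eventually.of_forall fun ω => ?_)
    · rw [Real.norm_eq_abs, abs_of_nonneg (le_max_right _ _)]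
      exact max_le (sub_le_self _ (mul_nonneg n.cast_nonneg (h0 ω))) (g0 ω)
    · refine tendsto_const_nhds.congr' ?_
      rcases eq_or_lt_of_le (h0 ω) with hz | hz
      · simp [← hz, hgh ω hz.symm]
      · obtain ⟨n, hn⟩ := exists_nat_ge (g ω / h ω)
        filter_upwards [eventually_ge_atTop n] with m hm
        rw [max_eq_right]
        have : g ω / h ω ≤ m := hn.trans (by exact_mod_cast hm)
        rw [div_le_iff₀ hz] at this
        linarith
  rw [integral_zero] at h1
  have hpos : ∀ i, 0 ≤ ∫ ω, g ω * f i ω ∂μ := fun i =>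
    integral_nonneg fun ω => mul_nonneg (g0 ω) (hfM i ω).1
  -- From `g ≤ n * h + (g - n * h)₊`. Below, `n` is fixed first to make the second term small, and
  -- only then is the limit along `L` taken.
  have hle : ∀ i (n : ℕ), ∫ ω, g ω * f i ω ∂μ ≤
      n * ∫ ω, h ω * f i ω ∂μ + M * ∫ ω, max (g ω - n * h ω) 0 ∂μ := by
    intro i n
    rw [← integral_const_mul, ← integral_const_mul, ← integral_add ((int hh i).const_mul _)
      ((ik n).const_mul _)]
    refine integral_mono (int hg i) (((int hh i).const_mul _).add ((ik n).const_mul _)) fun ω => ?_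
    have a1 := (hfM i ω).1
    have a2 := (hfM i ω).2
    have a3 := le_max_left (g ω - n * h ω) 0
    have a4 := le_max_right (g ω - n * h ω) 0
    simp only
    nlinarith [mul_le_mul_of_nonneg_right a3 a1, mul_le_mul_of_nonneg_left a2 a4]
  rw [Metric.tendsto_nhds]
  intro ε hε
  have h2 := h1.const_mul M
  rw [mul_zero] at h2
  obtain ⟨n, hn⟩ := (h2.eventually (gt_mem_nhds (half_pos hε))).exists
  have h3 := hlim.const_mul (n : ℝ)
  rw [mul_zero] at h3
  filter_upwards [h3.eventually (gt_mem_nhds (half_pos hε))] with i hi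
  rw [Real.dist_eq, sub_zero, abs_of_nonneg (hpos i)]
  linarith [hle i n]

variable {E : Type*} [NormedAddCommGroup E] [InnerProductSpace ℝ E] [FiniteDimensional ℝ E]

open scoped RealInnerProductSpace

/-- Each coordinate of the gradient in an orthonormal basis is a limit of difference quotients along
a sequence. -/
theorem aestronglyMeasurable_of_hasGradientAt {f : E → Ω → ℝ} {f' : Ω → E} {θ : E} {r : ℝ}
    (hr : 0 < r) (hf : ∀ η ∈ Metric.ball θ r, AEMeasurable (f η) μ)
    (h : ∀ᵐ ω ∂μ, HasGradientAt (fun η => f η ω) (f' ω) θ) : AEStronglyMeasurable f' μ := by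
  set b := stdOrthonormalBasis ℝ E
  have key : ∀ i, AEMeasurable (fun ω => ⟪b i, f' ω⟫) μ := by
    intro i
    -- The denominator `n + 2` keeps all step lengths positive and strictly below `r`, so only
    -- parameters in the ball are used.
    set c : ℕ → ℝ := fun n => r / (n + 2) with hc
    have cpos : ∀ n, 0 < c n := fun n => by simp only [hc]; positivity
    have clt : ∀ n, c n < r := fun n => by
      simp only [hc]
      rw [div_lt_iff₀ (by positivity)]
      nlinarith [n.cast_nonneg (α := ℝ)]
    have clim : Tendsto c atTop (𝓝 0) :=
      Tendsto.div_atTop tendsto_const_nhds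
        (tendsto_atTop_add_const_right _ _ tendsto_natCast_atTop_atTop)
    have clim' : Tendsto c atTop (𝓝[≠] 0) :=
      tendsto_nhdsWithin_iff.2 ⟨clim, Eventually.of_forall fun n => (cpos n).ne'⟩
    have mem : ∀ n, θ + c n • b i ∈ Metric.ball θ r := fun n => by
      rw [mem_ball_iff_norm, add_sub_cancel_left, norm_smul, b.norm_eq_one, mul_one,
        Real.norm_eq_abs, abs_of_pos (cpos n)]
      exact clt n
    refine aemeasurable_of_tendsto_metrizable_ae atTop
      (f := fun n ω => (c n)⁻¹ • (f (θ + c n • b i) ω - f θ ω))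
      (fun n => ((hf _ (mem n)).sub (hf _ (Metric.mem_ball_self hr))).const_mul (c n)⁻¹) ?_
    filter_upwards [h] with ω hω
    have h1 := hω.hasFDerivAt.hasLineDerivAt (b i)
    have h2 := (h1.tendsto_slope_zero).comp clim'
    simp only [InnerProductSpace.toDual_apply_apply] at h2
    rw [real_inner_comm]
    exact h2
  have h2 : f' = fun ω => ∑ i, ⟪b i, f' ω⟫ • b i := by
    funext ω
    exact (b.sum_repr' (f' ω)).symm
  rw [h2]
  exact Finset.aestronglyMeasurable_fun_sum _ fun i _ =>
    (key i).aestronglyMeasurable.smul_const _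

theorem norm_le_of_hasGradientAt {f : E → ℝ} {f' θ : E} {r K : ℝ} (hr : 0 < r) (hK : 0 ≤ K)
    (hf : HasGradientAt f f' θ) (hlip : ∀ η ∈ Metric.ball θ r, |f η - f θ| ≤ K * ‖η - θ‖) :
    ‖f'‖ ≤ K := by
  have := hf.hasFDerivAt.le_of_lip' hK (by
    filter_upwards [Metric.ball_mem_nhds θ hr] with η hη using hlip η hη)
  rwa [LinearIsometryEquiv.norm_map] at this

theorem integrable_gradient {f : E → Ω → ℝ} {f' : Ω → E} {θ : E} {r : ℝ} {G : Ω → ℝ}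
    (hr : 0 < r) (hf : ∀ η ∈ Metric.ball θ r, AEMeasurable (f η) μ) (hG : Integrable G μ)
    (hG0 : ∀ ω, 0 ≤ G ω)
    (hlip : ∀ᵐ ω ∂μ, ∀ η ∈ Metric.ball θ r, |f η ω - f θ ω| ≤ G ω * ‖η - θ‖)
    (h : ∀ᵐ ω ∂μ, HasGradientAt (fun η => f η ω) (f' ω) θ) : Integrable f' μ := by
  refine hG.mono' (aestronglyMeasurable_of_hasGradientAt hr hf h) ?_
  filter_upwards [h, hlip] with ω h1 h2 using norm_le_of_hasGradientAt hr (hG0 ω) h1 h2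

/-- The mean of the remainder in the definition of the gradient is of lower order, under a
local Lipschitz bound. -/
theorem tendsto_integral_remainder {f : E → Ω → ℝ} {f' : Ω → E} {θ : E} {r : ℝ} {G : Ω → ℝ}
    (hr : 0 < r) (hf : ∀ η ∈ Metric.ball θ r, AEMeasurable (f η) μ) (hG : Integrable G μ)
    (hG0 : ∀ ω, 0 ≤ G ω)
    (hlip : ∀ᵐ ω ∂μ, ∀ η ∈ Metric.ball θ r, |f η ω - f θ ω| ≤ G ω * ‖η - θ‖)
    (h : ∀ᵐ ω ∂μ, HasGradientAt (fun η => f η ω) (f' ω) θ) :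
    Tendsto (fun η => ‖η - θ‖⁻¹ * ∫ ω, |f η ω - f θ ω - ⟪f' ω, η - θ⟫| ∂μ) (𝓝 θ) (𝓝 0) := by
  have hm := aestronglyMeasurable_of_hasGradientAt hr hf h
  simp only [← integral_const_mul]
  rw [← integral_zero Ω ℝ (μ := μ)]
  refine tendsto_integral_filter_of_dominated_convergence (fun ω => 2 * G ω) ?_ ?_
    (hG.const_mul 2) ?_
  · filter_upwards [Metric.ball_mem_nhds θ hr] with η hη
    refine AEStronglyMeasurable.const_mul ?_ _
    have h1 := ((hf η hη).sub (hf θ (Metric.mem_ball_self hr))).aestronglyMeasurable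
    exact (h1.sub (hm.inner aestronglyMeasurable_const)).norm
  · filter_upwards [Metric.ball_mem_nhds θ hr] with η hη
    filter_upwards [h, hlip] with ω h1 h2
    have h3 := norm_le_of_hasGradientAt hr (hG0 ω) h1 h2
    rw [Real.norm_eq_abs, abs_mul, abs_abs, abs_of_nonneg (inv_nonneg.2 (norm_nonneg _))]
    rcases eq_or_ne η θ with rfl | hne
    · simpa using hG0 ω
    · have hp : 0 < ‖η - θ‖ := norm_pos_iff.2 (sub_ne_zero.2 hne)
      rw [inv_mul_le_iff₀ hp]
      calc |f η ω - f θ ω - ⟪f' ω, η - θ⟫| ≤ |f η ω - f θ ω| + |⟪f' ω, η - θ⟫| := abs_sub _ _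
        _ ≤ G ω * ‖η - θ‖ + ‖f' ω‖ * ‖η - θ‖ :=
          add_le_add (h2 η hη) (abs_real_inner_le_norm _ _)
        _ ≤ ‖η - θ‖ * (2 * G ω) := by nlinarith
  · filter_upwards [h] with ω h1
    exact hasGradientAt_iff_tendsto.1 h1

end Auxiliary

/-! ### Convexity of the objective and a bound for quantiles -/

section Objective

variable {Ω : Type*} [MeasurableSpace Ω] {μ : Measure Ω} [IsProbabilityMeasure μ] {Z : Ω → ℝ}
  {α : ℝ}

theorem convexOn_ruObjective (hZi : Integrable Z μ) (hα1 : α < 1) :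
    ConvexOn ℝ Set.univ (ruObjective μ Z α) := by
  refine ⟨convex_univ, fun x _ y _ a b ha hb hab => ?_⟩
  have hM : 0 ≤ 1 / (1 - α) := by
    have : 0 < 1 - α := by linarith
    positivity
  have ix := integrable_posPart_sub hZi x
  have iy := integrable_posPart_sub hZi y
  have key : ∫ ω, max (Z ω - (a * x + b * y)) 0 ∂μ ≤
      a * ∫ ω, max (Z ω - x) 0 ∂μ + b * ∫ ω, max (Z ω - y) 0 ∂μ := by
    rw [← integral_const_mul, ← integral_const_mul, ← integral_add (ix.const_mul a) (iy.const_mul b)]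
    refine integral_mono (integrable_posPart_sub hZi _) ((ix.const_mul a).add (iy.const_mul b))
      fun ω => max_le ?_ ?_
    · have h1 := mul_le_mul_of_nonneg_left (le_max_left (Z ω - x) 0) ha
      have h2 := mul_le_mul_of_nonneg_left (le_max_left (Z ω - y) 0) hb
      have h3 : Z ω = a * Z ω + b * Z ω := by rw [← add_mul, hab, one_mul]
      simp only
      linarith
    · exact add_nonneg (mul_nonneg ha (le_max_right _ _)) (mul_nonneg hb (le_max_right _ _))
  simp only [ruObjective, smul_eq_mul]
  have := mul_le_mul_of_nonneg_left key hM
  linarith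

/-- Markov's inequality for `{|Z| ≥ |q|}`: this set has mass at least `1 - α` if `q ≥ 0` and at
least `α` if `q ≤ 0`, hence at least `α (1 - α)` in both cases. -/
theorem IsQuantile.abs_le {q : ℝ} (hq : IsQuantile μ Z α q) (hZ : Measurable Z)
    (hZi : Integrable Z μ) (hα0 : 0 < α) (hα1 : α < 1) :
    |q| ≤ 1 / (α * (1 - α)) * ∫ ω, |Z ω| ∂μ := by
  have h1 : 0 < 1 - α := by linarith
  have hI : 0 ≤ ∫ ω, |Z ω| ∂μ := integral_nonneg fun _ => abs_nonneg _
  rw [one_div, ← div_eq_inv_mul, le_div_iff₀ (by positivity)]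
  have markov := mul_meas_ge_le_integral_of_nonneg (μ := μ) (f := fun ω => |Z ω|)
    (Filter.Eventually.of_forall fun _ => abs_nonneg _) hZi.abs |q|
  rcases le_total 0 q with h | h
  · have h2 : 1 - α ≤ μ.real {ω | |q| ≤ |Z ω|} := by
      have h3 : {ω | Z ω < q}ᶜ ⊆ {ω | |q| ≤ |Z ω|} := fun ω hω => by
        have h4 : q ≤ Z ω := not_lt.1 hω
        show |q| ≤ |Z ω|
        rw [abs_of_nonneg h]
        exact h4.trans (le_abs_self _)
      have h5 := measureReal_mono (μ := μ) h3
      rw [probReal_compl_eq_one_sub (measurableSet_lt hZ measurable_const)] at h5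
      linarith [hq.1]
    calc |q| * (α * (1 - α)) ≤ |q| * μ.real {ω | |q| ≤ |Z ω|} := by
          refine mul_le_mul_of_nonneg_left ?_ (abs_nonneg _)
          nlinarith
      _ ≤ _ := markov
  · have h2 : α ≤ μ.real {ω | |q| ≤ |Z ω|} := by
      refine hq.2.trans (measureReal_mono fun ω hω => ?_)
      have h4 : Z ω ≤ q := hω
      show |q| ≤ |Z ω|
      rw [abs_of_nonpos h, abs_of_nonpos (h4.trans h)]
      linarith
    calc |q| * (α * (1 - α)) ≤ |q| * μ.real {ω | |q| ≤ |Z ω|} := by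
          refine mul_le_mul_of_nonneg_left ?_ (abs_nonneg _)
          nlinarith
      _ ≤ _ := markov

end Objective

/-! ### Regular families of densities and random variables -/

section Sensitivity

open Set
open scoped RealInnerProductSpace

variable {E : Type*} [NormedAddCommGroup E] [InnerProductSpace ℝ E] [FiniteDimensional ℝ E]
  {Ω : Type*} [MeasurableSpace Ω]

/-- A family of random variables `X η` and of probability densities `ρ η` with respect to `μ`,
with `ρ θ = 1`, which are differentiable at `θ` and satisfy Lipschitz bounds near `θ`. -/
structure RegularFamily (μ : Measure Ω) (θ : E) (r C : ℝ) (ρ X : E → Ω → ℝ) (W : Ω → ℝ)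
    (g Y : Ω → E) : Prop where
  r_pos : 0 < r
  r_le_one : r ≤ 1
  C_nonneg : 0 ≤ C
  W_nonneg : ∀ ω, 0 ≤ W ω
  integrable_W : Integrable W μ
  measurable_dens : ∀ η, Measurable (ρ η)
  dens_nonneg : ∀ η ω, 0 ≤ ρ η ω
  isProbabilityMeasure : ∀ η, IsProbabilityMeasure (μ.withDensity fun ω => ENNReal.ofReal (ρ η ω))
  dens_self : ∀ᵐ ω ∂μ, ρ θ ω = 1
  dens_lip : ∀ᵐ ω ∂μ, ∀ η ∈ Metric.ball θ r, |ρ η ω - 1| ≤ C * ‖η - θ‖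
  dens_grad : ∀ᵐ ω ∂μ, HasGradientAt (fun η => ρ η ω) (g ω) θ
  measurable_var : ∀ η ∈ Metric.ball θ r, Measurable (X η)
  var_le : ∀ ω, |X θ ω| ≤ W ω
  var_lip : ∀ᵐ ω ∂μ, ∀ η ∈ Metric.ball θ r, |X η ω - X θ ω| ≤ W ω * ‖η - θ‖
  var_grad : ∀ᵐ ω ∂μ, HasGradientAt (fun η => X η ω) (Y ω) θ

/-- The measure with the density `ρ` with respect to `μ`. -/
def densMeasure (μ : Measure Ω) (ρ : Ω → ℝ) : Measure Ω := μ.withDensity fun ω => ENNReal.ofReal (ρ ω)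

theorem integral_densMeasure {F : Type*} [NormedAddCommGroup F] [NormedSpace ℝ F] {μ : Measure Ω}
    {ρ : Ω → ℝ} (hρ : Measurable ρ) (h0 : ∀ ω, 0 ≤ ρ ω) (f : Ω → F) :
    ∫ ω, f ω ∂(densMeasure μ ρ) = ∫ ω, ρ ω • f ω ∂μ := by
  rw [densMeasure, integral_withDensity_eq_integral_toReal_smul hρ.ennreal_ofReal
    (Eventually.of_forall fun _ => ENNReal.ofReal_lt_top)]
  simp only [ENNReal.toReal_ofReal (h0 _)]

theorem integrable_densMeasure_iff {F : Type*} [NormedAddCommGroup F] [NormedSpace ℝ F]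
    {μ : Measure Ω} {ρ : Ω → ℝ} (hρ : Measurable ρ) (h0 : ∀ ω, 0 ≤ ρ ω) {f : Ω → F} :
    Integrable f (densMeasure μ ρ) ↔ Integrable (fun ω => ρ ω • f ω) μ := by
  rw [densMeasure, integrable_withDensity_iff_integrable_smul' hρ.ennreal_ofReal
    (Eventually.of_forall fun _ => ENNReal.ofReal_lt_top)]
  simp only [ENNReal.toReal_ofReal (h0 _)]

namespace RegularFamily

variable {μ : Measure Ω} {θ : E} {r C α l : ℝ} {ρ X : E → Ω → ℝ} {W : Ω → ℝ} {g Y : Ω → E}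
  {ξ : Ω → ℝ} {η : E}

theorem mem_ball (h : RegularFamily μ θ r C ρ X W g Y) : θ ∈ Metric.ball θ r :=
  Metric.mem_ball_self h.r_pos

theorem isProb (h : RegularFamily μ θ r C ρ X W g Y) (η : E) :
    IsProbabilityMeasure (densMeasure μ (ρ η)) := h.isProbabilityMeasure η

theorem densMeasure_self (h : RegularFamily μ θ r C ρ X W g Y) : densMeasure μ (ρ θ) = μ := by
  rw [densMeasure, withDensity_congr_ae (g := 1), withDensity_one]
  filter_upwards [h.dens_self] with ω hω
  simp [hω]

theorem isProb_self (h : RegularFamily μ θ r C ρ X W g Y) : IsProbabilityMeasure μ := by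
  have := h.isProb θ
  rwa [h.densMeasure_self] at this

theorem isBoxed_dens (_ : RegularFamily μ θ r C ρ X W g Y) (hξ : IsBoxed μ α ξ) (η : E) :
    IsBoxed (densMeasure μ (ρ η)) α ξ :=
  have hac : densMeasure μ (ρ η) ≪ μ := withDensity_absolutelyContinuous _ _
  ⟨hξ.1.mono_ac hac, hac.ae_le hξ.2⟩

theorem norm_sub_le_one (h : RegularFamily μ θ r C ρ X W g Y) (hη : η ∈ Metric.ball θ r) :
    ‖η - θ‖ ≤ 1 := (mem_ball_iff_norm.1 hη).le.trans h.r_le_one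

/-- Lipschitz bound for a positive part or a difference, weighted by the density. -/
theorem weighted_lip (h : RegularFamily μ θ r C ρ X W g Y) {φ : ℝ → ℝ} (l : ℝ)
    (hφ : ∀ x y, |φ x - φ y| ≤ |x - y|) (hφl : ∀ x, |φ x| ≤ |x - l|) :
    ∀ᵐ ω ∂μ, ∀ η ∈ Metric.ball θ r,
      |ρ η ω * φ (X η ω) - ρ θ ω * φ (X θ ω)| ≤ (1 + 2 * C) * (W ω + |l|) * ‖η - θ‖ := by
  filter_upwards [h.dens_self, h.dens_lip, h.var_lip] with ω h1 h2 h3 η hη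
  have n1 := h.norm_sub_le_one hη
  have n0 := norm_nonneg (η - θ)
  have d := h2 η hη
  have hC := h.C_nonneg
  have hW := h.W_nonneg ω
  have e1 : ρ η ω ≤ 1 + C := by
    have := le_abs_self (ρ η ω - 1)
    nlinarith
  have e2 : |φ (X η ω) - φ (X θ ω)| ≤ W ω * ‖η - θ‖ := (hφ _ _).trans (h3 η hη)
  have e3 : |φ (X θ ω)| ≤ W ω + |l| :=
    (hφl _).trans ((abs_sub _ _).trans (add_le_add_left (h.var_le ω) _))
  have hl := abs_nonneg l
  rw [h1, one_mul]
  calc |ρ η ω * φ (X η ω) - φ (X θ ω)|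
      = |ρ η ω * (φ (X η ω) - φ (X θ ω)) + (ρ η ω - 1) * φ (X θ ω)| := by ring_nf
    _ ≤ ρ η ω * |φ (X η ω) - φ (X θ ω)| + |ρ η ω - 1| * |φ (X θ ω)| := by
        refine (abs_add_le _ _).trans (le_of_eq ?_)
        rw [abs_mul, abs_mul, abs_of_nonneg (h.dens_nonneg η ω)]
    _ ≤ (1 + C) * (W ω * ‖η - θ‖) + (C * ‖η - θ‖) * (W ω + |l|) := by
        refine add_le_add ?_ ?_
        · exact mul_le_mul e1 e2 (abs_nonneg _) (by positivity)
        · exact mul_le_mul d e3 (abs_nonneg _) (by positivity)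
    _ ≤ (1 + 2 * C) * (W ω + |l|) * ‖η - θ‖ := by
        have : 0 ≤ |l| * ‖η - θ‖ := by positivity
        have : 0 ≤ C * (|l| * ‖η - θ‖) := by positivity
        nlinarith

theorem integrable_bound (h : RegularFamily μ θ r C ρ X W g Y) (l : ℝ) :
    Integrable (fun ω => (1 + 2 * C) * (W ω + |l|)) μ :=
  have := h.isProb_self
  (h.integrable_W.add (integrable_const _)).const_mul _

theorem bound_nonneg (h : RegularFamily μ θ r C ρ X W g Y) (l : ℝ) (ω : Ω) :
    0 ≤ (1 + 2 * C) * (W ω + |l|) := by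
  have := h.C_nonneg
  have := h.W_nonneg ω
  positivity

theorem integrable_var_self (h : RegularFamily μ θ r C ρ X W g Y) : Integrable (X θ) μ :=
  h.integrable_W.mono' (h.measurable_var θ h.mem_ball).aestronglyMeasurable
    (Eventually.of_forall h.var_le)

theorem dens_le (h : RegularFamily μ θ r C ρ X W g Y) :
    ∀ᵐ ω ∂μ, ∀ η ∈ Metric.ball θ r, ρ η ω ≤ 1 + C := by
  filter_upwards [h.dens_lip] with ω h2 η hη
  have := h.norm_sub_le_one hη
  have := le_abs_self (ρ η ω - 1)
  have := h2 η hη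
  have := h.C_nonneg
  nlinarith [norm_nonneg (η - θ)]

theorem integrable_of_le (h : RegularFamily μ θ r C ρ X W g Y) (hη : η ∈ Metric.ball θ r)
    {f : Ω → ℝ} (hf : Integrable f μ) : Integrable f (densMeasure μ (ρ η)) := by
  rw [integrable_densMeasure_iff (h.measurable_dens η) (h.dens_nonneg η)]
  refine hf.bdd_smul (1 + C) (h.measurable_dens η).aestronglyMeasurable ?_
  filter_upwards [h.dens_le] with ω hω
  rw [Real.norm_eq_abs, abs_of_nonneg (h.dens_nonneg η ω)]
  exact hω η hη

theorem integrable_var_base (h : RegularFamily μ θ r C ρ X W g Y) (hη : η ∈ Metric.ball θ r) :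
    Integrable (X η) μ := by
  refine (h.integrable_W.const_mul 2).mono' (h.measurable_var η hη).aestronglyMeasurable ?_
  filter_upwards [h.var_lip] with ω h3
  have a1 := h3 η hη
  have a2 := h.var_le ω
  have a3 : |X η ω| ≤ |X η ω - X θ ω| + |X θ ω| := by
    simpa using abs_add_le (X η ω - X θ ω) (X θ ω)
  have := h.norm_sub_le_one hη
  have := h.W_nonneg ω
  rw [Real.norm_eq_abs]
  nlinarith

theorem integral_abs_var_le (h : RegularFamily μ θ r C ρ X W g Y) (hη : η ∈ Metric.ball θ r) :
    ∫ ω, |X η ω| ∂(densMeasure μ (ρ η)) ≤ 2 * (1 + C) * ∫ ω, W ω ∂μ := by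
  rw [integral_densMeasure (h.measurable_dens η) (h.dens_nonneg η), ← integral_const_mul]
  refine integral_mono_ae ?_ (h.integrable_W.const_mul _) ?_
  · exact (integrable_densMeasure_iff (h.measurable_dens η) (h.dens_nonneg η)).1
      (h.integrable_of_le hη (h.integrable_var_base hη).abs)
  · filter_upwards [h.var_lip, h.dens_le] with ω h3 h4
    have a1 := h3 η hη
    have a2 := h.var_le ω
    have a3 : |X η ω| ≤ |X η ω - X θ ω| + |X θ ω| := by
      simpa using abs_add_le (X η ω - X θ ω) (X θ ω)
    have := h.norm_sub_le_one hη
    have := h.W_nonneg ω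
    have a4 : |X η ω| ≤ 2 * W ω := by nlinarith
    have := h.C_nonneg
    calc ρ η ω • |X η ω| ≤ (1 + C) * (2 * W ω) :=
          mul_le_mul (h4 η hη) a4 (abs_nonneg _) (by positivity)
      _ = _ := by ring

theorem integrable_var (h : RegularFamily μ θ r C ρ X W g Y) (hη : η ∈ Metric.ball θ r) :
    Integrable (X η) (densMeasure μ (ρ η)) := h.integrable_of_le hη (h.integrable_var_base hη)

/-- Lipschitz bound for the reduced Lagrangian. -/
theorem abs_integral_sub_le (h : RegularFamily μ θ r C ρ X W g Y) (hα1 : α < 1)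
    (hξ : IsBoxed μ α ξ) (hη : η ∈ Metric.ball θ r) (l : ℝ) :
    |∫ ω, (X η ω - l) * ξ ω ∂(densMeasure μ (ρ η)) - ∫ ω, (X θ ω - l) * ξ ω ∂μ| ≤
      1 / (1 - α) * ((1 + 2 * C) * (∫ ω, W ω ∂μ + |l|)) * ‖η - θ‖ := by
  have := h.isProb_self
  have := h.isProb η
  have i1 : Integrable (fun ω => ρ η ω * (X η ω - l)) μ :=
    (integrable_densMeasure_iff (h.measurable_dens η) (h.dens_nonneg η)).1
      ((h.integrable_var hη).sub (integrable_const l))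
  have i2 : Integrable (fun ω => X θ ω - l) μ := h.integrable_var_self.sub (integrable_const l)
  have e1 : ∫ ω, (X η ω - l) * ξ ω ∂(densMeasure μ (ρ η)) = ∫ ω, ξ ω • (ρ η ω * (X η ω - l)) ∂μ := by
    rw [integral_densMeasure (h.measurable_dens η) (h.dens_nonneg η)]
    simp only [smul_eq_mul]
    congr 1; funext ω; ring
  have e2 : ∫ ω, (X θ ω - l) * ξ ω ∂μ = ∫ ω, ξ ω • (X θ ω - l) ∂μ := by
    simp only [smul_eq_mul, mul_comm]
  have e3 : ∫ ω, ξ ω • (ρ η ω * (X η ω - l)) ∂μ - ∫ ω, ξ ω • (X θ ω - l) ∂μ =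
      ∫ ω, ξ ω • (ρ η ω * (X η ω - l) - (X θ ω - l)) ∂μ := by
    rw [← integral_sub (hξ.integrable_smul i1) (hξ.integrable_smul i2)]
    simp only [smul_sub]
  rw [e1, e2, e3, ← Real.norm_eq_abs]
  refine (hξ.norm_integral_smul_le (i1.sub i2)).trans ?_
  rw [mul_assoc]
  have h1 : 0 < 1 - α := by linarith
  refine mul_le_mul_of_nonneg_left ?_ (by positivity)
  have e4 : (1 + 2 * C) * (∫ ω, W ω ∂μ + |l|) * ‖η - θ‖ =
      ∫ ω, (1 + 2 * C) * (W ω + |l|) * ‖η - θ‖ ∂μ := by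
    rw [integral_mul_const, integral_const_mul, integral_add h.integrable_W (integrable_const _)]
    simp
  rw [e4]
  refine integral_mono_ae (i1.sub i2).norm ((h.integrable_bound l).mul_const _) ?_
  filter_upwards [h.weighted_lip (φ := fun x => x - l) l (fun x y => by simp) (fun x => le_rfl),
    h.dens_self] with ω h2 h3
  have h4 := h2 η hη
  rw [h3, one_mul] at h4
  exact h4

/-- Convergence of the objective of Rockafellar and Uryasev. -/
theorem tendsto_ruObjective (h : RegularFamily μ θ r C ρ X W g Y) (α m : ℝ) :
    Tendsto (fun η => ruObjective (densMeasure μ (ρ η)) (X η) α m) (𝓝 θ)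
      (𝓝 (ruObjective μ (X θ) α m)) := by
  have := h.isProb_self
  unfold ruObjective
  refine (Tendsto.const_mul _ ?_).const_add m
  have e : ∫ ω, max (X θ ω - m) 0 ∂μ = ∫ ω, ρ θ ω • max (X θ ω - m) 0 ∂μ := by
    refine integral_congr_ae ?_
    filter_upwards [h.dens_self] with ω hω
    rw [hω, one_smul]
  simp only [integral_densMeasure (h.measurable_dens _) (h.dens_nonneg _), e]
  have lip := h.weighted_lip (φ := fun x => max (x - m) 0) m
    (fun x y => (abs_max_sub_max_le_abs _ _ _).trans (by simp)) (fun x => by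
      have := abs_max_sub_max_le_abs (x - m) 0 0
      simpa using this)
  have i0 : Integrable (fun ω => ρ θ ω • max (X θ ω - m) 0) μ :=
    (integrable_posPart_sub h.integrable_var_self m).congr (by
      filter_upwards [h.dens_self] with ω hω
      rw [hω, one_smul])
  refine tendsto_integral_filter_of_dominated_convergence
    (fun ω => |ρ θ ω • max (X θ ω - m) 0| + (1 + 2 * C) * (W ω + |m|)) ?_ ?_
    (i0.abs.add (h.integrable_bound m)) ?_
  · filter_upwards [Metric.ball_mem_nhds θ h.r_pos] with η hη
    exact ((h.measurable_dens η).smul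
      (((h.measurable_var η hη).sub_const m).max measurable_const)).aestronglyMeasurable
  · filter_upwards [Metric.ball_mem_nhds θ h.r_pos] with η hη
    filter_upwards [lip] with ω hω
    have a1 := hω η hη
    have a2 := h.norm_sub_le_one hη
    have a3 := h.bound_nonneg m ω
    have a4 := abs_add_le (ρ η ω * max (X η ω - m) 0 - ρ θ ω * max (X θ ω - m) 0)
      (ρ θ ω * max (X θ ω - m) 0)
    rw [sub_add_cancel] at a4
    rw [Real.norm_eq_abs, smul_eq_mul, smul_eq_mul]
    nlinarith
  · filter_upwards [h.dens_grad, h.var_grad] with ω h1 h2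
    exact h1.hasFDerivAt.continuousAt.smul
      ((h2.hasFDerivAt.continuousAt.sub continuousAt_const).max continuousAt_const)

/-- Quantiles minimise the objective, and the minimiser at `θ` is unique. Pointwise convergence at
the three points `l` and `l ± ε` suffices: near `θ` the values at `l ± ε` exceed the one at `l`, and
by convexity no minimiser can then lie at distance `ε` or more from `l`. -/
theorem tendsto_quantile (h : RegularFamily μ θ r C ρ X W g Y) (hα0 : 0 < α) (hα1 : α < 1)
    (huniq : ∀ q₁ q₂, IsQuantile μ (X θ) α q₁ → IsQuantile μ (X θ) α q₂ → q₁ = q₂)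
    (hl : IsQuantile μ (X θ) α l) {q : E → ℝ}
    (hq : ∀ η ∈ Metric.ball θ r, IsQuantile (densMeasure μ (ρ η)) (X η) α (q η)) :
    Tendsto q (𝓝 θ) (𝓝 l) := by
  have := h.isProb_self
  have hm := h.measurable_var θ h.mem_ball
  have hi := h.integrable_var_self
  have strict : ∀ m, m ≠ l → ∀ᶠ η in 𝓝 θ, ruObjective (densMeasure μ (ρ η)) (X η) α l <
      ruObjective (densMeasure μ (ρ η)) (X η) α m := fun m hne => by
    refine (h.tendsto_ruObjective α l).eventually_lt (h.tendsto_ruObjective α m) ?_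
    by_contra! hle
    refine hne (huniq _ _ (isQuantile_of_ruObjective_le hm hi hα0 hα1 ?_) hl)
    rwa [hl.CVaR_eq hm hi hα0 hα1]
  rw [Metric.tendsto_nhds]
  intro ε hε
  filter_upwards [strict (l + ε) (by linarith), strict (l - ε) (by linarith),
    Metric.ball_mem_nhds θ h.r_pos] with η h1 h2 hη
  have := h.isProb η
  have hmη := h.measurable_var η hη
  have hiη := h.integrable_var hη
  have hmin : ruObjective (densMeasure μ (ρ η)) (X η) α (q η) ≤
      ruObjective (densMeasure μ (ρ η)) (X η) α l := by
    rw [← (hq η hη).CVaR_eq hmη hiη hα0 hα1]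
    exact CVaR_le_ruObjective hmη hiη hα0 hα1 l
  have hconv := convexOn_ruObjective hiη hα1
  rw [Real.dist_eq, abs_lt]
  constructor
  · by_contra! hle
    have h3 := hconv.le_max_of_mem_Icc (mem_univ (q η)) (mem_univ l) (z := l - ε)
      ⟨by linarith, by linarith⟩
    rw [max_eq_right hmin] at h3
    linarith
  · by_contra! hle
    have h3 := hconv.le_max_of_mem_Icc (mem_univ l) (mem_univ (q η)) (z := l + ε)
      ⟨by linarith, by linarith⟩
    rw [max_eq_left hmin] at h3
    linarith

end RegularFamily
end Sensitivity

/-! ### The envelope theorem -/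

section Sensitivity

open Set
open scoped RealInnerProductSpace

variable {E : Type*} [NormedAddCommGroup E] [InnerProductSpace ℝ E] [FiniteDimensional ℝ E]
  {Ω : Type*} [MeasurableSpace Ω]

namespace RegularFamily

variable {μ : Measure Ω} {θ : E} {r C α l : ℝ} {ρ X : E → Ω → ℝ} {W : Ω → ℝ} {g Y : Ω → E}
  {ξ : Ω → ℝ} {η : E}

/-- The saddle-point density at `θ` competes in the problem at `η`. There its mean need not be one,
so the multiplier has to be a quantile `q` at `η`; at `θ` its mean is one and any multiplier may be
used. -/
theorem le_CVaR_sub (h : RegularFamily μ θ r C ρ X W g Y) (hα0 : 0 < α) (hα1 : α < 1)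
    (hs : IsSaddlePoint μ (X θ) α ξ l) (hη : η ∈ Metric.ball θ r) {q : ℝ}
    (hq : IsQuantile (densMeasure μ (ρ η)) (X η) α q) :
    ∫ ω, (X η ω - q) * ξ ω ∂(densMeasure μ (ρ η)) - ∫ ω, (X θ ω - q) * ξ ω ∂μ ≤
      CVaR (densMeasure μ (ρ η)) (X η) α - CVaR μ (X θ) α := by
  have := h.isProb_self
  have := h.isProb η
  have hm := h.measurable_var θ h.mem_ball
  have hi := h.integrable_var_self
  have hb := h.isBoxed_dens hs.1 η
  have h1 := hb.lagrangian_le (h.integrable_var hη) q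
  rw [lagrangian_eq (h.integrable_var hη) hb,
    ← hq.CVaR_eq (h.measurable_var η hη) (h.integrable_var hη) hα0 hα1] at h1
  have h2 := integral_sub_const_mul hi hs.1 q
  rw [← hs.CVaR_eq hm hi hα0 hα1, hs.integral_eq_one hm hi hα1] at h2
  linarith

/-- The roles are exchanged: the density of a saddle-point at `η` competes at `θ`, with the
multiplier `l`. The box constraint under `μ` is a separate hypothesis, because `ρ η` may vanish on
sets of positive measure. -/
theorem CVaR_sub_le (h : RegularFamily μ θ r C ρ X W g Y) (hα0 : 0 < α) (hα1 : α < 1)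
    (hl : IsQuantile μ (X θ) α l) (hη : η ∈ Metric.ball θ r) {q : ℝ}
    (hξ : IsBoxed μ α ξ) (hs : IsSaddlePoint (densMeasure μ (ρ η)) (X η) α ξ q) :
    CVaR (densMeasure μ (ρ η)) (X η) α - CVaR μ (X θ) α ≤
    ∫ ω, (X η ω - l) * ξ ω ∂(densMeasure μ (ρ η)) - ∫ ω, (X θ ω - l) * ξ ω ∂μ := by
  have := h.isProb_self
  have := h.isProb η
  have hm := h.measurable_var θ h.mem_ball
  have hi := h.integrable_var_self
  have hm' := h.measurable_var η hη
  have hi' := h.integrable_var hη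
  have h1 := hξ.lagrangian_le hi l
  rw [lagrangian_eq hi hξ, ← hl.CVaR_eq hm hi hα0 hα1] at h1
  have h2 := integral_sub_const_mul hi' hs.1 l
  rw [← hs.CVaR_eq hm' hi' hα0 hα1, hs.integral_eq_one hm' hi' hα1] at h2
  linarith

/-- The multipliers in the two one-sided bounds are quantiles, hence at most a multiple of `∫ W`.
The Lipschitz constant is thus a multiple of `∫ W` with no additive term, which is what the backward
induction needs. -/
theorem abs_CVaR_sub_le (h : RegularFamily μ θ r C ρ X W g Y) (hα0 : 0 < α) (hα1 : α < 1)
    (hη : η ∈ Metric.ball θ r) :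
    |CVaR (densMeasure μ (ρ η)) (X η) α - CVaR μ (X θ) α| ≤
      1 / (1 - α) * ((1 + 2 * C) * (1 + 1 / (α * (1 - α)) * (2 * (1 + C)))) * (∫ ω, W ω ∂μ)
        * ‖η - θ‖ := by
  have := h.isProb_self
  have := h.isProb η
  have hC := h.C_nonneg
  have h1 : 0 < 1 - α := by linarith
  have hI : 0 ≤ ∫ ω, W ω ∂μ := integral_nonneg h.W_nonneg
  have bound : ∀ η ∈ Metric.ball θ r, ∀ q, IsQuantile (densMeasure μ (ρ η)) (X η) α q →
      |q| ≤ 1 / (α * (1 - α)) * (2 * (1 + C)) * ∫ ω, W ω ∂μ := fun η hη q hq => by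
    have := h.isProb η
    refine (hq.abs_le (h.measurable_var η hη) (h.integrable_var hη) hα0 hα1).trans ?_
    rw [mul_assoc]
    exact mul_le_mul_of_nonneg_left (h.integral_abs_var_le hη) (by positivity)
  have bound' : ∀ q, |q| ≤ 1 / (α * (1 - α)) * (2 * (1 + C)) * ∫ ω, W ω ∂μ →
      1 / (1 - α) * ((1 + 2 * C) * (∫ ω, W ω ∂μ + |q|)) * ‖η - θ‖ ≤
      1 / (1 - α) * ((1 + 2 * C) * (1 + 1 / (α * (1 - α)) * (2 * (1 + C)))) * (∫ ω, W ω ∂μ)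
        * ‖η - θ‖ := fun q hq => by
    refine mul_le_mul_of_nonneg_right ?_ (norm_nonneg _)
    rw [mul_assoc (1 / (1 - α)) (_ * _), mul_assoc (1 + 2 * C),
      add_mul 1 (1 / (α * (1 - α)) * (2 * (1 + C))), one_mul]
    exact mul_le_mul_of_nonneg_left
      (mul_le_mul_of_nonneg_left (add_le_add_right hq _) (by positivity)) (by positivity)
  have ql := isQuantile_VaR (μ := μ) (h.measurable_var θ h.mem_ball) hα0 hα1
  have qη := isQuantile_VaR (μ := densMeasure μ (ρ η)) (h.measurable_var η hη) hα0 hα1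
  obtain ⟨ξ, -, -, hξ⟩ := exists_isSaddlePoint (h.measurable_var θ h.mem_ball)
    h.integrable_var_self hα1 ql
  obtain ⟨ζ, mζ, bζ, hζ⟩ := exists_isSaddlePoint (h.measurable_var η hη)
    (h.integrable_var hη) hα1 qη
  have ql' := ql
  rw [← h.densMeasure_self] at ql'
  have b1 := bound' _ (bound θ h.mem_ball _ ql')
  rw [h.densMeasure_self] at b1
  have b2 := bound' _ (bound η hη _ qη)
  have e1 := h.CVaR_sub_le hα0 hα1 ql hη (isBoxed_of_forall mζ bζ) hζ
  have e2 := h.le_CVaR_sub hα0 hα1 hξ hη qη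
  have e3 := (abs_le.1 (h.abs_integral_sub_le hα1 (isBoxed_of_forall mζ bζ) hη (VaR μ (X θ) α))).2
  have e4 := (abs_le.1 (h.abs_integral_sub_le hα1 hξ.1 hη (VaR (densMeasure μ (ρ η)) (X η) α))).1
  rw [abs_le]
  constructor <;> linarith

theorem abs_integral_dens_sub_le (h : RegularFamily μ θ r C ρ X W g Y) (hα1 : α < 1)
    (hξ : IsBoxed μ α ξ) (hη : η ∈ Metric.ball θ r) :
    |∫ ω, ξ ω ∂(densMeasure μ (ρ η)) - ∫ ω, ξ ω ∂μ| ≤ 1 / (1 - α) * (C * ‖η - θ‖) := by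
  have := h.isProb_self
  have h1 : 0 < 1 - α := by linarith
  have i1 : Integrable (fun ω => ρ η ω - 1) μ := by
    refine Integrable.of_bound ((h.measurable_dens η).sub_const 1).aestronglyMeasurable
      (C * ‖η - θ‖) ?_
    filter_upwards [h.dens_lip] with ω hω using hω η hη
  have i2 : Integrable (fun ω => ρ η ω • ξ ω) μ := by
    have := h.isProb η
    exact (integrable_densMeasure_iff (h.measurable_dens η) (h.dens_nonneg η)).1
      (h.isBoxed_dens hξ η).integrable
  rw [integral_densMeasure (h.measurable_dens η) (h.dens_nonneg η), ← integral_sub i2 hξ.integrable,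
    ← Real.norm_eq_abs]
  have e : ∀ ω, ρ η ω • ξ ω - ξ ω = ξ ω • (ρ η ω - 1) := fun ω => by
    simp only [smul_eq_mul]; ring
  simp only [e]
  refine (hξ.norm_integral_smul_le i1).trans (mul_le_mul_of_nonneg_left ?_ (by positivity))
  calc ∫ ω, ‖ρ η ω - 1‖ ∂μ ≤ ∫ _, C * ‖η - θ‖ ∂μ := by
        refine integral_mono_ae i1.norm (integrable_const _) ?_
        filter_upwards [h.dens_lip] with ω hω using hω η hη
    _ = C * ‖η - θ‖ := by simp

/-- The integrand of the gradient of the Lagrangian, apart from the factor `ξ`. -/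
def gradIntegrand (X : E → Ω → ℝ) (g Y : Ω → E) (θ : E) (l : ℝ) (ω : Ω) : E :=
  (X θ ω - l) • g ω + Y ω

theorem hasGradientAt_weighted (h : RegularFamily μ θ r C ρ X W g Y) (l : ℝ) :
    ∀ᵐ ω ∂μ, HasGradientAt (fun η => ρ η ω * (X η ω - l)) (gradIntegrand X g Y θ l ω) θ := by
  filter_upwards [h.dens_self, h.dens_grad, h.var_grad] with ω h1 h2 h3
  have h4 := h2.hasFDerivAt.mul (h3.hasFDerivAt.sub_const l)
  rw [hasGradientAt_iff_hasFDerivAt]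
  refine h4.congr_fderiv ?_
  rw [h1, one_smul, gradIntegrand, map_add, map_smul, add_comm]

theorem score_bound (h : RegularFamily μ θ r C ρ X W g Y) :
    AEStronglyMeasurable g μ ∧ ∀ᵐ ω ∂μ, ‖g ω‖ ≤ C := by
  refine ⟨aestronglyMeasurable_of_hasGradientAt h.r_pos
    (fun η _ => (h.measurable_dens η).aemeasurable) h.dens_grad, ?_⟩
  filter_upwards [h.dens_self, h.dens_lip, h.dens_grad] with ω h1 h2 h3
  exact norm_le_of_hasGradientAt h.r_pos h.C_nonneg h3 (by rwa [h1])

theorem integrable_posPart_smul (h : RegularFamily μ θ r C ρ X W g Y) (l : ℝ) :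
    Integrable (fun ω => max (X θ ω - l) 0 • g ω) μ := by
  have := h.isProb_self
  exact (integrable_posPart_sub h.integrable_var_self l).smul_bdd C h.score_bound.1
    h.score_bound.2

theorem integrable_Y (h : RegularFamily μ θ r C ρ X W g Y) : Integrable Y μ :=
  integrable_gradient h.r_pos (fun η hη => (h.measurable_var η hη).aemeasurable) h.integrable_W
    h.W_nonneg h.var_lip h.var_grad

theorem integrable_gradIntegrand (h : RegularFamily μ θ r C ρ X W g Y) (l : ℝ) :
    Integrable (gradIntegrand X g Y θ l) μ := by
  have := h.isProb_self
  exact ((h.integrable_var_self.sub (integrable_const l)).smul_bdd C h.score_bound.1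
    h.score_bound.2).add h.integrable_Y

/-- Complementarity removes `ξ` from the score term, which then depends on the saddle-point only
through `l`. -/
theorem integral_smul_gradIntegrand (h : RegularFamily μ θ r C ρ X W g Y) (hα1 : α < 1)
    (hs : IsSaddlePoint μ (X θ) α ξ l) :
    ∫ ω, ξ ω • gradIntegrand X g Y θ l ω ∂μ =
      (1 / (1 - α)) • ∫ ω, max (X θ ω - l) 0 • g ω ∂μ + ∫ ω, ξ ω • Y ω ∂μ := by
  have := h.isProb_self
  have i1 : Integrable (fun ω => (1 / (1 - α)) • max (X θ ω - l) 0 • g ω) μ :=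
    (h.integrable_posPart_smul l).smul _
  rw [← integral_smul, ← integral_add i1 (hs.1.integrable_smul h.integrable_Y)]
  refine integral_congr_ae ?_
  filter_upwards [((isSaddlePoint_iff (h.measurable_var θ h.mem_ball) h.integrable_var_self
    hα1).1 hs).2.2] with ω hω
  rw [gradIntegrand, smul_add, smul_smul, smul_smul, mul_comm, hω]

/-- First order expansion of the Lagrangian, uniformly in the density `ξ`. -/
theorem abs_remainder_le (h : RegularFamily μ θ r C ρ X W g Y) (l : ℝ)
    (hξ : IsBoxed μ α ξ) (hη : η ∈ Metric.ball θ r) :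
    |∫ ω, (X η ω - l) * ξ ω ∂(densMeasure μ (ρ η)) - ∫ ω, (X θ ω - l) * ξ ω ∂μ -
      ⟪∫ ω, ξ ω • gradIntegrand X g Y θ l ω ∂μ, η - θ⟫| ≤
    1 / (1 - α) * ∫ ω, |ρ η ω * (X η ω - l) - ρ θ ω * (X θ ω - l) -
      ⟪gradIntegrand X g Y θ l ω, η - θ⟫| ∂μ := by
  have := h.isProb_self
  have := h.isProb η
  have i1 : Integrable (fun ω => ρ η ω * (X η ω - l)) μ :=
    (integrable_densMeasure_iff (h.measurable_dens η) (h.dens_nonneg η)).1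
      ((h.integrable_var hη).sub (integrable_const l))
  have e0 : (fun ω => X θ ω - l) =ᵐ[μ] fun ω => ρ θ ω * (X θ ω - l) := by
    filter_upwards [h.dens_self] with ω h3
    rw [h3, one_mul]
  have i2 : Integrable (fun ω => ρ θ ω * (X θ ω - l)) μ :=
    (h.integrable_var_self.sub (integrable_const l)).congr e0
  have i3 : Integrable (fun ω => ⟪gradIntegrand X g Y θ l ω, η - θ⟫) μ :=
    (h.integrable_gradIntegrand l).inner_const _
  have e1 : ∫ ω, (X η ω - l) * ξ ω ∂(densMeasure μ (ρ η)) = ∫ ω, ξ ω • (ρ η ω * (X η ω - l)) ∂μ := by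
    rw [integral_densMeasure (h.measurable_dens η) (h.dens_nonneg η)]
    simp only [smul_eq_mul]
    congr 1; funext ω; ring
  have e2 : ∫ ω, (X θ ω - l) * ξ ω ∂μ = ∫ ω, ξ ω • (ρ θ ω * (X θ ω - l)) ∂μ := by
    refine integral_congr_ae ?_
    filter_upwards [h.dens_self] with ω h3
    rw [h3, one_mul, smul_eq_mul, mul_comm]
  have e3 : ⟪∫ ω, ξ ω • gradIntegrand X g Y θ l ω ∂μ, η - θ⟫ =
      ∫ ω, ξ ω • ⟪gradIntegrand X g Y θ l ω, η - θ⟫ ∂μ := by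
    rw [real_inner_comm, ← integral_inner (hξ.integrable_smul (h.integrable_gradIntegrand l))]
    refine integral_congr_ae (Eventually.of_forall fun ω => ?_)
    simp only
    rw [real_inner_comm, real_inner_smul_left, smul_eq_mul]
  have i12 : Integrable (fun ω => ξ ω • (ρ η ω * (X η ω - l)) - ξ ω • (ρ θ ω * (X θ ω - l))) μ :=
    (hξ.integrable_smul i1).sub (hξ.integrable_smul i2)
  rw [e1, e2, e3, ← integral_sub (hξ.integrable_smul i1) (hξ.integrable_smul i2),
    ← integral_sub i12 (hξ.integrable_smul i3)]
  simp only [← smul_sub]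
  exact hξ.norm_integral_smul_le ((i1.sub i2).sub i3)

/-- Maximising densities for nearby parameters are close in the mean to saddle-points. -/
theorem tendsto_integral_smul_gradIntegrand (h : RegularFamily μ θ r C ρ X W g Y) (hα0 : 0 < α)
    (hα1 : α < 1)
    (hY : ∀ ξ₁ ξ₂ l₁ l₂, IsSaddlePoint μ (X θ) α ξ₁ l₁ → IsSaddlePoint μ (X θ) α ξ₂ l₂ →
      ∫ ω, ξ₁ ω • Y ω ∂μ = ∫ ω, ξ₂ ω • Y ω ∂μ)
    (hs : IsSaddlePoint μ (X θ) α ξ l) {ζ : E → Ω → ℝ} {q : E → ℝ}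
    (hζm : ∀ η, Measurable (ζ η)) (hζb : ∀ η ω, 0 ≤ ζ η ω ∧ ζ η ω ≤ 1 / (1 - α))
    (hζ : ∀ η ∈ Metric.ball θ r, IsSaddlePoint (densMeasure μ (ρ η)) (X η) α (ζ η) (q η)) :
    Tendsto (fun η => ∫ ω, ζ η ω • gradIntegrand X g Y θ l ω ∂μ) (𝓝 θ)
      (𝓝 (∫ ω, ξ ω • gradIntegrand X g Y θ l ω ∂μ)) := by
  have := h.isProb_self
  have hm := h.measurable_var θ h.mem_ball
  have hi := h.integrable_var_self
  have hl := hs.isQuantile hm hi hα1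
  have h1α : 0 < 1 - α := by linarith
  have bζ : ∀ η, IsBoxed μ α (ζ η) := fun η => isBoxed_of_forall (hζm η) (hζb η)
  have mlo : Measurable (lowerDensity (X θ) α l) := measurable_lowerDensity hm
  have lo0 := lowerDensity_nonneg hα1 (X θ) l
  have lo1 : ∀ ω, lowerDensity (X θ) α l ω ≤ 1 / (1 - α) := fun ω =>
    (lowerDensity_le_upperDensity hα1 _ l ω).trans (upperDensity_le hα1 _ l ω)
  have ball := Metric.ball_mem_nhds θ h.r_pos
  have hnorm : Tendsto (fun η => ‖η - θ‖) (𝓝 θ) (𝓝 0) := by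
    have : Continuous fun η : E => ‖η - θ‖ := by fun_prop
    simpa using this.tendsto θ
  have dist_bound : ∀ a b : ℝ, 0 ≤ a ∧ a ≤ 1 / (1 - α) → 0 ≤ b ∧ b ≤ 1 / (1 - α) →
      0 ≤ |a - b| ∧ |a - b| ≤ 1 / (1 - α) := fun a b ha hb =>
    ⟨abs_nonneg _, abs_le.2 ⟨by linarith [ha.1, hb.2], by linarith [hb.1, ha.2]⟩⟩
  -- the defect of `ζ η` in the maximisation of the Lagrangian at `θ`
  have s1 : Tendsto (fun η => ∫ ω, |X θ ω - l| * |lowerDensity (X θ) α l ω - ζ η ω| ∂μ) (𝓝 θ)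
      (𝓝 0) := by
    set K := 1 / (1 - α) * ((1 + 2 * C) * (∫ ω, W ω ∂μ + |l|))
    set K' := 1 / (1 - α) * ((1 + 2 * C) * (1 + 1 / (α * (1 - α)) * (2 * (1 + C)))) * (∫ ω, W ω ∂μ)
    -- Pointwise, `(X - l)₊/(1-α) - (X - l) ζ` is `|X - l|` times the distance of `ζ` from the lower
    -- density.
    have e1 : ∀ η, ∫ ω, |X θ ω - l| * |lowerDensity (X θ) α l ω - ζ η ω| ∂μ =
        CVaR μ (X θ) α - l - ∫ ω, (X θ ω - l) * ζ η ω ∂μ := fun η => by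
      have i1 := (integrable_posPart_sub hi l).const_mul (1 / (1 - α))
      have i2 : Integrable (fun ω => (X θ ω - l) * ζ η ω) μ :=
        (bζ η).integrable_mul (hi.sub (integrable_const l))
      rw [hl.CVaR_eq hm hi hα0 hα1, ruObjective, add_sub_cancel_left, ← integral_const_mul,
        ← integral_sub i1 i2]
      refine integral_congr_ae (Eventually.of_forall fun ω => ?_)
      simp only [lowerDensity, indicator_apply, mem_ofPred_eq]
      split_ifs with hlt
      · rw [abs_of_pos (sub_pos.2 hlt), abs_of_nonneg (sub_nonneg.2 (hζb η ω).2),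
          max_eq_left (sub_pos.2 hlt).le]
        ring
      · rw [abs_of_nonpos (by linarith), zero_sub, abs_neg, abs_of_nonneg (hζb η ω).1,
          max_eq_right (by linarith)]
        ring
    -- Under the law at `η` the density `ζ η` has mean one, so its Lagrangian with multiplier `l` is
    -- the CVaR at `η`. The defect is then controlled by the Lipschitz bounds for CVaR and for the
    -- Lagrangian.
    refine squeeze_zero' (g := fun η => (K' + K) * ‖η - θ‖) (Eventually.of_forall fun η =>
      integral_nonneg fun ω => mul_nonneg (abs_nonneg _) (abs_nonneg _)) ?_ ?_
    · filter_upwards [ball] with η hη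
      have := h.isProb η
      have hm' := h.measurable_var η hη
      have hi' := h.integrable_var hη
      rw [e1]
      have a1 := (abs_le.1 (h.abs_CVaR_sub_le hα0 hα1 hη)).1
      have a2 := (abs_le.1 (h.abs_integral_sub_le hα1 (bζ η) hη l)).2
      have a3 := integral_sub_const_mul hi' (hζ η hη).1 l
      rw [← (hζ η hη).CVaR_eq hm' hi' hα0 hα1, (hζ η hη).integral_eq_one hm' hi' hα1] at a3
      linarith
    · simpa using hnorm.const_mul (K' + K)
  -- The weight `|X θ - l|` vanishes only where `X θ = l`, so it can be exchanged for the indicator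
  -- of the complement.
  have s2 : Tendsto (fun η => ∫ ω, {ω | X θ ω ≠ l}.indicator
      (fun ω => |lowerDensity (X θ) α l ω - ζ η ω|) ω ∂μ) (𝓝 θ) (𝓝 0) := by
    have hms : MeasurableSet {ω | X θ ω ≠ l} := hm (measurableSet_singleton l).compl
    have := tendsto_integral_mul_zero (h := fun ω => |X θ ω - l|)
      (g := {ω | X θ ω ≠ l}.indicator fun _ => 1) (hi.sub (integrable_const l)).abs
      ((integrable_const _).indicator hms) (fun ω => abs_nonneg _)
      (fun ω => indicator_nonneg (fun _ _ => zero_le_one) ω)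
      (fun ω hω => indicator_of_notMem (not_not_intro (sub_eq_zero.1 (abs_eq_zero.1 hω))) _)
      (fun η => (mlo.sub (hζm η)).abs)
      (fun η ω => dist_bound _ _ ⟨lo0 ω, lo1 ω⟩ (hζb η ω)) s1
    refine this.congr fun η => integral_congr_ae (Eventually.of_forall fun ω => ?_)
    simp only [indicator_apply]
    split_ifs <;> simp
  have near := fun η => exists_isSaddlePoint_near hm hi hα1 hl (hζm η) (bζ η)
  choose ν hνm hνb hνs hν using near
  -- The mean of `ζ η` under `μ` differs from one only by the effect of the change of density, which
  -- is of order `‖η - θ‖`.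
  have s3 : Tendsto (fun η => ∫ ω, 1 * |ν η ω - ζ η ω| ∂μ) (𝓝 θ) (𝓝 0) := by
    simp only [one_mul]
    refine squeeze_zero' (Eventually.of_forall fun η => integral_nonneg fun ω => abs_nonneg _)
      (g := fun η => 2 * ∫ ω, {ω | X θ ω ≠ l}.indicator
        (fun ω => |lowerDensity (X θ) α l ω - ζ η ω|) ω ∂μ + 1 / (1 - α) * (C * ‖η - θ‖)) ?_ ?_
    · filter_upwards [ball] with η hη
      have := h.isProb η
      refine (hν η).trans (add_le_add_right ?_ _)
      have := h.abs_integral_dens_sub_le hα1 (bζ η) hη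
      rwa [(hζ η hη).integral_eq_one (h.measurable_var η hη) (h.integrable_var hη) hα1,
        abs_sub_comm] at this
    · simpa using (s2.const_mul 2).add ((hnorm.const_mul C).const_mul (1 / (1 - α)))
  have iD := h.integrable_gradIntegrand l
  have s4 := tendsto_integral_mul_zero (integrable_const (1 : ℝ)) iD.norm (fun _ => zero_le_one)
    (fun ω => norm_nonneg _) (fun _ h => absurd h one_ne_zero)
    (fun η => ((hνm η).sub (hζm η)).abs) (fun η ω => dist_bound _ _ (hνb η ω) (hζb η ω)) s3
  rw [tendsto_iff_norm_sub_tendsto_zero]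
  refine squeeze_zero (fun _ => norm_nonneg _) (fun η => ?_) s4
  -- The nearby saddle-points `ν η` have the same multiplier `l` as `ξ`, so the score terms agree;
  -- `hY` equates the remaining ones.
  have e2 : ∫ ω, ξ ω • gradIntegrand X g Y θ l ω ∂μ = ∫ ω, ν η ω • gradIntegrand X g Y θ l ω ∂μ := by
    rw [h.integral_smul_gradIntegrand hα1 hs, h.integral_smul_gradIntegrand hα1 (hνs η),
      hY _ _ _ _ hs (hνs η)]
  rw [e2, ← integral_sub ((bζ η).integrable_smul iD) ((hνs η).1.integrable_smul iD)]
  refine (norm_integral_le_integral_norm _).trans (le_of_eq (integral_congr_ae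
    (Eventually.of_forall fun ω => ?_)))
  simp only
  rw [← sub_smul, norm_smul, Real.norm_eq_abs, abs_sub_comm, mul_comm, Pi.sub_apply]

/-- Envelope theorem for the conditional value-at-risk of a regular family. -/
theorem hasGradientAt_CVaR (h : RegularFamily μ θ r C ρ X W g Y) (hα0 : 0 < α) (hα1 : α < 1)
    (huniq : ∀ q₁ q₂, IsQuantile μ (X θ) α q₁ → IsQuantile μ (X θ) α q₂ → q₁ = q₂)
    (hY : ∀ ξ₁ ξ₂ l₁ l₂, IsSaddlePoint μ (X θ) α ξ₁ l₁ → IsSaddlePoint μ (X θ) α ξ₂ l₂ →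
      ∫ ω, ξ₁ ω • Y ω ∂μ = ∫ ω, ξ₂ ω • Y ω ∂μ)
    (hs : IsSaddlePoint μ (X θ) α ξ l) :
    HasGradientAt (fun η => CVaR (densMeasure μ (ρ η)) (X η) α)
      ((1 / (1 - α)) • ∫ ω, max (X θ ω - l) 0 • g ω ∂μ + ∫ ω, ξ ω • Y ω ∂μ) θ := by
  have := h.isProb_self
  have hm := h.measurable_var θ h.mem_ball
  have hi := h.integrable_var_self
  have hl := hs.isQuantile hm hi hα1
  have h1α : 0 < 1 - α := by linarith
  rw [← h.integral_smul_gradIntegrand hα1 hs]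
  -- Outside the ball the zero function serves as a default, so that measurability and the box
  -- constraint hold for all `η`.
  have ex : ∀ η, ∃ ζ : Ω → ℝ, Measurable ζ ∧ (∀ ω, 0 ≤ ζ ω ∧ ζ ω ≤ 1 / (1 - α)) ∧
      (η ∈ Metric.ball θ r → IsSaddlePoint (densMeasure μ (ρ η)) (X η) α ζ
        (VaR (densMeasure μ (ρ η)) (X η) α)) := fun η => by
    by_cases hη : η ∈ Metric.ball θ r
    · have := h.isProb η
      obtain ⟨ζ, h1, h2, h3⟩ := exists_isSaddlePoint (h.measurable_var η hη) (h.integrable_var hη)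
        hα1 (isQuantile_VaR (h.measurable_var η hη) hα0 hα1)
      exact ⟨ζ, h1, h2, fun _ => h3⟩
    · exact ⟨fun _ => 0, measurable_const, fun _ => ⟨le_rfl, by positivity⟩, fun h' => absurd h' hη⟩
  choose ζ hζm hζb hζ using ex
  have bζ : ∀ η, IsBoxed μ α (ζ η) := fun η => isBoxed_of_forall (hζm η) (hζb η)
  set q : E → ℝ := fun η => VaR (densMeasure μ (ρ η)) (X η) α with hq
  have hqq : ∀ η ∈ Metric.ball θ r, IsQuantile (densMeasure μ (ρ η)) (X η) α (q η) := fun η hη => by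
    have := h.isProb η
    exact isQuantile_VaR (h.measurable_var η hη) hα0 hα1
  have qlim := h.tendsto_quantile hα0 hα1 huniq hl hqq
  have Dlim := h.tendsto_integral_smul_gradIntegrand hα0 hα1 hY hs hζm hζb (fun η => hζ η)
  have mZ : ∀ η ∈ Metric.ball θ r, AEMeasurable (fun ω => ρ η ω * (X η ω - l)) μ := fun η hη =>
    ((h.measurable_dens η).mul ((h.measurable_var η hη).sub_const l)).aemeasurable
  have Rlim := tendsto_integral_remainder h.r_pos mZ (h.integrable_bound l) (h.bound_nonneg l)
    (h.weighted_lip (φ := fun x => x - l) l (fun x y => by simp) fun x => le_rfl)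
    (h.hasGradientAt_weighted l)
  set R : E → ℝ := fun η => ∫ ω, |ρ η ω * (X η ω - l) - ρ θ ω * (X θ ω - l) -
    ⟪gradIntegrand X g Y θ l ω, η - θ⟫| ∂μ
  set D := ∫ ω, ξ ω • gradIntegrand X g Y θ l ω ∂μ
  rw [hasGradientAt_iff_tendsto, h.densMeasure_self]
  -- Three errors: the remainder of the Lagrangian, uniform in the density; the replacement of `q η`
  -- by `l` in the lower bound; and the replacement of `ζ η` by `ξ` in the gradient of the upper
  -- bound.
  refine squeeze_zero' (g := fun η => 1 / (1 - α) * (‖η - θ‖⁻¹ * R η) +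
    (|l - q η| * (1 / (1 - α) * C) + ‖∫ ω, ζ η ω • gradIntegrand X g Y θ l ω ∂μ - D‖))
    (Eventually.of_forall fun η => by positivity) ?_ ?_
  · filter_upwards [Metric.ball_mem_nhds θ h.r_pos] with η hη
    have := h.isProb η
    rcases eq_or_ne η θ with rfl | hne
    · have hR : 0 ≤ R η := integral_nonneg fun ω => abs_nonneg _
      have := h.C_nonneg
      simp only [sub_self, norm_zero, inv_zero, zero_mul, mul_zero, zero_add]
      positivity
    have hp : 0 < ‖η - θ‖ := norm_pos_iff.2 (sub_ne_zero.2 hne)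
    have up := h.CVaR_sub_le hα0 hα1 hl hη (bζ η) (hζ η hη)
    have lo := h.le_CVaR_sub hα0 hα1 hs hη (hqq η hη)
    have r1 := (abs_le.1 (h.abs_remainder_le l (bζ η) hη)).2
    have r2 := (abs_le.1 (h.abs_remainder_le l hs.1 hη)).1
    have b1 := h.abs_integral_dens_sub_le hα1 hs.1 hη
    have hb := h.isBoxed_dens hs.1 η
    have c1 := integral_sub_const_mul (h.integrable_var hη) hb l
    have c2 := integral_sub_const_mul (h.integrable_var hη) hb (q η)
    have c3 := integral_sub_const_mul hi hs.1 l
    have c4 := integral_sub_const_mul hi hs.1 (q η)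
    -- In the lower bound, passing from the multiplier `q η` to `l` costs `l - q η` times the change
    -- of the mean of `ξ`: a null sequence times a term of order `‖η - θ‖`.
    have d1 : |(l - q η) * (∫ ω, ξ ω ∂(densMeasure μ (ρ η)) - ∫ ω, ξ ω ∂μ)| ≤
        |l - q η| * (1 / (1 - α) * (C * ‖η - θ‖)) := by
      rw [abs_mul]
      exact mul_le_mul_of_nonneg_left b1 (abs_nonneg _)
    have d2 := (abs_le.1 d1).1
    have d3 : ⟪∫ ω, ζ η ω • gradIntegrand X g Y θ l ω ∂μ, η - θ⟫ - ⟪D, η - θ⟫ ≤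
        ‖∫ ω, ζ η ω • gradIntegrand X g Y θ l ω ∂μ - D‖ * ‖η - θ‖ := by
      rw [← inner_sub_left]
      exact real_inner_le_norm _ _
    have n1 : 0 ≤ |l - q η| * (1 / (1 - α) * (C * ‖η - θ‖)) := (abs_nonneg _).trans d1
    have n2 : 0 ≤ ‖∫ ω, ζ η ω • gradIntegrand X g Y θ l ω ∂μ - D‖ * ‖η - θ‖ := by positivity
    have fin : |CVaR (densMeasure μ (ρ η)) (X η) α - CVaR μ (X θ) α - ⟪D, η - θ⟫| ≤
        1 / (1 - α) * R η + (|l - q η| * (1 / (1 - α) * (C * ‖η - θ‖)) +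
          ‖∫ ω, ζ η ω • gradIntegrand X g Y θ l ω ∂μ - D‖ * ‖η - θ‖) := by
      rw [abs_le]
      constructor
      · linarith
      · linarith
    rw [Real.norm_eq_abs, inv_mul_le_iff₀ hp]
    refine fin.trans (le_of_eq ?_)
    field_simp
  · have l1 : Tendsto (fun η => |l - q η| * (1 / (1 - α) * C)) (𝓝 θ) (𝓝 0) := by
      have := ((tendsto_const_nhds (x := l)).sub qlim).abs.mul_const (1 / (1 - α) * C)
      simpa using this
    have l2 := tendsto_iff_norm_sub_tendsto_zero.1 Dlim
    simpa using (Rlim.const_mul (1 / (1 - α))).add (l1.add l2)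

end RegularFamily
end Sensitivity

/-- Convexity makes the objective continuous, so rational multipliers suffice. A countable infimum
is what makes the value function measurable in the state. -/
theorem CVaR_eq_iInf_rat {Ω : Type*} [MeasurableSpace Ω] {μ : Measure Ω} [IsProbabilityMeasure μ]
    {Z : Ω → ℝ} {α : ℝ} (hZ : Measurable Z) (hZi : Integrable Z μ) (hα0 : 0 < α) (hα1 : α < 1) :
    CVaR μ Z α = ⨅ q : ℚ, ruObjective μ Z α q := by
  have hbd : BddBelow (Set.range fun q : ℚ => ruObjective μ Z α q) :=
    ⟨CVaR μ Z α, by rintro _ ⟨q, rfl⟩; exact CVaR_le_ruObjective hZ hZi hα0 hα1 q⟩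
  refine le_antisymm (le_ciInf fun q => CVaR_le_ruObjective hZ hZi hα0 hα1 q) ?_
  have hcont : Continuous (ruObjective μ Z α) :=
    continuousOn_univ.1 ((convexOn_ruObjective hZi hα1).continuousOn isOpen_univ)
  rw [CVaR_eq_ruObjective_VaR hZ hZi hα0 hα1]
  exact Rat.denseRange_cast.induction_on
    (p := fun l : ℝ => ⨅ q : ℚ, ruObjective μ Z α q ≤ ruObjective μ Z α l) _
    (isClosed_le continuous_const hcont) fun q => ciInf_le hbd q

/-- Each side is the integral of `Y` against the second marginal of the measure with density `ξ`,
and these marginals agree on all measurable sets. This is how uniqueness of the reweighted law of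
the next state enters. -/
theorem integral_smul_comp_snd_eq {A S E : Type*} [MeasurableSpace A] [MeasurableSpace S]
    [NormedAddCommGroup E] [NormedSpace ℝ E] {μ : Measure (A × S)} [IsProbabilityMeasure μ] {α : ℝ}
    {ξ₁ ξ₂ : A × S → ℝ} (h₁ : IsBoxed μ α ξ₁) (h₂ : IsBoxed μ α ξ₂)
    (h : ∀ B : Set S, MeasurableSet B →
      ∫ x in {x | x.2 ∈ B}, ξ₁ x ∂μ = ∫ x in {x | x.2 ∈ B}, ξ₂ x ∂μ)
    {Y : S → E} (hY : ∀ ν : Measure S, AEStronglyMeasurable Y ν) :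
    ∫ x, ξ₁ x • Y x.2 ∂μ = ∫ x, ξ₂ x • Y x.2 ∂μ := by
  have key : ∀ ξ : A × S → ℝ, IsBoxed μ α ξ →
      ∫ x, ξ x • Y x.2 ∂μ =
        ∫ s, Y s ∂((μ.withDensity fun x => ENNReal.ofReal (ξ x)).map Prod.snd) := fun ξ hξ => by
    rw [integral_map measurable_snd.aemeasurable (hY _),
      integral_withDensity_eq_integral_toReal_smul₀ hξ.1.ennreal_ofReal
        (Eventually.of_forall fun _ => ENNReal.ofReal_lt_top)]
    refine integral_congr_ae ?_
    filter_upwards [hξ.2] with x hx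
    rw [ENNReal.toReal_ofReal hx.1]
  have key2 : ∀ ξ : A × S → ℝ, IsBoxed μ α ξ → ∀ B : Set S, MeasurableSet B →
      ((μ.withDensity fun x => ENNReal.ofReal (ξ x)).map Prod.snd) B =
        ENNReal.ofReal (∫ x in {x | x.2 ∈ B}, ξ x ∂μ) := fun ξ hξ B hB => by
    rw [Measure.map_apply measurable_snd hB, withDensity_apply _ (measurable_snd hB),
      ofReal_integral_eq_lintegral_ofReal hξ.integrable.integrableOn
        (ae_restrict_of_ae (hξ.2.mono fun _ h => h.1))]
    rfl
  rw [key _ h₁, key _ h₂]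
  congr 1
  refine Measure.ext fun B hB => ?_
  rw [key2 _ h₁ B hB, key2 _ h₂ B hB, h B hB]

namespace ParamMDP

/-! ### Measurability and integrability for the decision process -/

section Measurability

variable {Θ A S : Type*} [MeasurableSpace A] [MeasurableSpace S]
  {νA : Measure A} {νS : Measure S} {T t : ℕ}

theorem prob_nonneg (M : ParamMDP Θ νA νS) (t : ℕ) (η : Θ) (s : S) (a : A) (s' : S) :
    0 ≤ M.prob t η s a s' := mul_nonneg (M.trans_nonneg _ _ _ _) (M.policy_nonneg _ _ _ _)

theorem measurable_prob (M : ParamMDP Θ νA νS) (t : ℕ) (η : Θ) :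
    Measurable fun x : S × A × S => M.prob t η x.1 x.2.1 x.2.2 :=
  (M.measurable_trans t).mul ((M.measurable_policy t η).comp
    (measurable_fst.prodMk (measurable_fst.comp measurable_snd)))

theorem absCost_terminal (M : ParamMDP Θ νA νS) (T : ℕ) (s : S) (θ : Θ) :
    M.absCost T T s θ = 0 := by
  simp [absCost, absCostAux]

theorem absCost_eq (M : ParamMDP Θ νA νS) (ht : t < T) (s : S) (θ : Θ) :
    M.absCost T t s θ =
      ∫⁻ x, (‖M.cost t s x.1 x.2‖ₑ + M.absCost T (t + 1) x.2 θ) ∂(M.law t θ s) := by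
  obtain ⟨k, rfl⟩ := Nat.exists_eq_add_of_lt ht
  have h1 : t + k + 1 - t = k + 1 := by omega
  have h2 : t + k + 1 - (t + 1) = k := by omega
  have h3 : t + k + 1 - (k + 1) = t := by omega
  unfold absCost
  rw [h1, h2, absCostAux, h3]

/-- The likelihood ratio. -/
def ratio (M : ParamMDP Θ νA νS) (t : ℕ) (θ : Θ) (s : S) (η : Θ) (x : A × S) : ℝ :=
  M.prob t η s x.1 x.2 / M.prob t θ s x.1 x.2

theorem ratio_nonneg (M : ParamMDP Θ νA νS) (t : ℕ) (θ : Θ) (s : S) (η : Θ) (x : A × S) :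
    0 ≤ M.ratio t θ s η x := div_nonneg (M.prob_nonneg _ _ _ _ _) (M.prob_nonneg _ _ _ _ _)

theorem measurable_riskToGo {α : ℝ} {M : ParamMDP Θ νA νS} {η : Θ}
    (hV : Measurable fun s => M.value T α (t + 1) s η) :
    Measurable fun x : S × A × S => M.riskToGo T α t x.1 η x.2 :=
  (M.measurable_cost t).add (hV.comp (measurable_snd.comp measurable_snd))

theorem measurable_prob_right (M : ParamMDP Θ νA νS) (t : ℕ) (η : Θ) (s : S) :
    Measurable fun x : A × S => M.prob t η s x.1 x.2 :=
  (M.measurable_prob t η).comp measurable_prodMk_left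

theorem measurable_ratio (M : ParamMDP Θ νA νS) (t : ℕ) (θ : Θ) (s : S) (η : Θ) :
    Measurable (M.ratio t θ s η) :=
  (M.measurable_prob_right t η s).div (M.measurable_prob_right t θ s)

theorem ae_prob_ne_zero (M : ParamMDP Θ νA νS) (t : ℕ) (θ : Θ) (s : S) :
    ∀ᵐ x ∂(M.law t θ s), M.prob t θ s x.1 x.2 ≠ 0 := by
  rw [law, ae_withDensity_iff (M.measurable_prob_right t θ s).ennreal_ofReal]
  refine Eventually.of_forall fun x hx h => hx ?_
  rw [h, ENNReal.ofReal_zero]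

variable [SigmaFinite νS]

theorem isProbabilityMeasure_law (M : ParamMDP Θ νA νS) (t : ℕ) (η : Θ) (s : S) :
    IsProbabilityMeasure (M.law t η s) := by
  refine ⟨?_⟩
  rw [law, withDensity_apply _ MeasurableSet.univ, Measure.restrict_univ,
    lintegral_prod _ (M.measurable_prob_right t η s).ennreal_ofReal.aemeasurable]
  have : ∀ a, ∫⁻ s', ENNReal.ofReal (M.prob t η s a s') ∂νS =
      ENNReal.ofReal (M.policy t η s a) := fun a => by
    simp only [prob, ENNReal.ofReal_mul (M.trans_nonneg _ _ _ _)]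
    rw [lintegral_mul_const, M.lintegral_trans, one_mul]
    have h : Measurable fun s' : S => (s, a, s') := by fun_prop
    exact ((M.measurable_trans t).comp h).ennreal_ofReal
  simp only [this]
  exact M.lintegral_policy t η s

variable [SigmaFinite νA]

theorem measurable_CVaR_law (M : ParamMDP Θ νA νS) (t : ℕ) (η : Θ) {α : ℝ} (hα0 : 0 < α)
    (hα1 : α < 1) {X : S → A × S → ℝ} (hX : Measurable fun x : S × A × S => X x.1 x.2)
    (hXi : ∀ s, Integrable (X s) (M.law t η s)) :
    Measurable fun s => CVaR (M.law t η s) (X s) α := by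
  have e : ∀ s, CVaR (M.law t η s) (X s) α = ⨅ q : ℚ, ruObjective (M.law t η s) (X s) α q :=
    fun s => by
      have := M.isProbabilityMeasure_law t η s
      exact CVaR_eq_iInf_rat (hX.comp measurable_prodMk_left) (hXi s) hα0 hα1
  simp only [e]
  refine Measurable.iInf fun q => ?_
  unfold ruObjective
  refine (Measurable.const_mul ?_ _).const_add _
  have e2 : ∀ s, ∫ x, max (X s x - q) 0 ∂(M.law t η s) =
      ∫ x, M.prob t η s x.1 x.2 • max (X s x - q) 0 ∂(νA.prod νS) := fun s =>
    integral_densMeasure (M.measurable_prob_right t η s) (fun x => M.prob_nonneg t η s x.1 x.2) _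
  simp only [e2]
  have h : Measurable fun x : S × A × S =>
      M.prob t η x.1 x.2.1 x.2.2 • max (X x.1 x.2 - q) 0 :=
    (M.measurable_prob t η).smul ((hX.sub_const _).max measurable_const)
  exact (StronglyMeasurable.integral_prod_right
    (f := fun s x => M.prob t η s x.1 x.2 • max (X s x - q) 0) h.stronglyMeasurable).measurable

theorem measurable_absCostAux (M : ParamMDP Θ νA νS) (T : ℕ) (θ : Θ) (k : ℕ) :
    Measurable (M.absCostAux T θ k) := by
  induction k with
  | zero => exact measurable_const
  | succ k ih =>
    have hF : Measurable fun x : S × A × S => ‖M.cost (T - (k + 1)) x.1 x.2.1 x.2.2‖ₑ +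
        M.absCostAux T θ k x.2.2 :=
      (M.measurable_cost _).enorm.add (ih.comp (measurable_snd.comp measurable_snd))
    have e : M.absCostAux T θ (k + 1) = fun s => ∫⁻ x,
        ENNReal.ofReal (M.prob (T - (k + 1)) θ s x.1 x.2) *
        (‖M.cost (T - (k + 1)) s x.1 x.2‖ₑ + M.absCostAux T θ k x.2) ∂(νA.prod νS) := by
      funext s
      have hFs : Measurable fun x : A × S => ‖M.cost (T - (k + 1)) s x.1 x.2‖ₑ +
          M.absCostAux T θ k x.2 := hF.comp measurable_prodMk_left
      exact lintegral_withDensity_eq_lintegral_mul _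
        (M.measurable_prob_right _ θ s).ennreal_ofReal hFs
    rw [e]
    exact Measurable.lintegral_prod_right' ((M.measurable_prob _ θ).ennreal_ofReal.mul hF)

theorem measurable_absCost (M : ParamMDP Θ νA νS) (T t : ℕ) (θ : Θ) :
    Measurable fun s => M.absCost T t s θ := M.measurable_absCostAux T θ (T - t)

theorem integrable_absCost (M : ParamMDP Θ νA νS) {θ : Θ} (hmom : ∀ t < T, ∀ s, M.absCost T t s θ < ∞)
    (ht : t < T) (s : S) :
    Integrable (fun x => |M.cost t s x.1 x.2| + (M.absCost T (t + 1) x.2 θ).toReal) (M.law t θ s) ∧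
    ∫ x, (|M.cost t s x.1 x.2| + (M.absCost T (t + 1) x.2 θ).toReal) ∂(M.law t θ s) =
      (M.absCost T t s θ).toReal := by
  -- The moment hypothesis covers only times before `T`; at `T` the expected cost is zero by
  -- definition.
  have hfin : ∀ s', M.absCost T (t + 1) s' θ ≠ ∞ := fun s' => by
    rcases eq_or_lt_of_le (Nat.succ_le_of_lt ht) with h | h
    · rw [show t + 1 = T from h, absCost_terminal]
      exact ENNReal.zero_ne_top
    · exact (hmom _ h s').ne
  have e : ∀ x : A × S, |M.cost t s x.1 x.2| + (M.absCost T (t + 1) x.2 θ).toReal =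
      (‖M.cost t s x.1 x.2‖ₑ + M.absCost T (t + 1) x.2 θ).toReal := fun x => by
    rw [ENNReal.toReal_add enorm_ne_top (hfin _), toReal_enorm, Real.norm_eq_abs]
  have hm : Measurable fun x : A × S => ‖M.cost t s x.1 x.2‖ₑ + M.absCost T (t + 1) x.2 θ :=
    ((M.measurable_cost t).comp measurable_prodMk_left).enorm.add
      ((M.measurable_absCost T (t + 1) θ).comp measurable_snd)
  simp only [e]
  have h := hmom t ht s
  rw [absCost_eq M ht] at h ⊢
  refine ⟨integrable_toReal_of_lintegral_ne_top hm.aemeasurable h.ne,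
    integral_toReal hm.aemeasurable (Eventually.of_forall fun x => ?_)⟩
  exact ENNReal.add_lt_top.2 ⟨enorm_lt_top, (hfin _).lt_top⟩

end Measurability

/-! ### Likelihood ratios and regularity of the value function -/

section Regular

variable {E A S : Type*} [NormedAddCommGroup E] [InnerProductSpace ℝ E] [FiniteDimensional ℝ E]
  [MeasurableSpace A] [MeasurableSpace S]
  {νA : Measure A} {νS : Measure S} {T t : ℕ} {θ : E} {r C : ℝ}
  {M : ParamMDP E νA νS}

/-- The score function has the bound `C` on the ball of radius `r` around `θ`, and the support of
the transition probabilities does not depend on the parameter. -/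
structure RegularAt (M : ParamMDP E νA νS) (T : ℕ) (θ : E) (r C : ℝ) : Prop where
  r_pos : 0 < r
  r_le_one : r ≤ 1
  C_nonneg : 0 ≤ C
  prob_ne_zero : ∀ t < T, ∀ s a s' η η', M.prob t η s a s' ≠ 0 → M.prob t η' s a s' ≠ 0
  differentiableAt : ∀ t < T, ∀ s a s', M.prob t θ s a s' ≠ 0 →
    ∀ η, DifferentiableAt ℝ (fun η => Real.log (M.prob t η s a s')) η
  norm_gradient_le : ∀ η ∈ Metric.ball θ r, ∀ t < T, ∀ s a s', M.prob t θ s a s' ≠ 0 →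
    ‖gradient (fun η => Real.log (M.prob t η s a s')) η‖ ≤ C

/-- The transition density does not depend on the parameter and drops out of the score. Splitting
the logarithm needs both factors nonzero for every parameter. -/
theorem RegularAt.gradient_log_policy (h : M.RegularAt T θ r C) (ht : t < T) {s : S} {x : A × S}
    (hx : M.prob t θ s x.1 x.2 ≠ 0) :
    gradient (fun η => Real.log (M.prob t η s x.1 x.2)) θ =
      gradient (fun η => Real.log (M.policy t η s x.1)) θ := by
  have e : (fun η => Real.log (M.policy t η s x.1)) = fun η =>
      Real.log (M.prob t η s x.1 x.2) - Real.log (M.trans t s x.1 x.2) := by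
    funext η
    have h1 := h.prob_ne_zero t ht s x.1 x.2 θ η hx
    rw [prob] at h1
    rw [prob, Real.log_mul (left_ne_zero_of_mul h1) (right_ne_zero_of_mul h1)]
    ring
  rw [e, gradient, gradient, fderiv_sub_const]

theorem exists_regularAt
    (hdiff : ∀ t < T, ∀ s a s', (∃ θ₁, M.prob t θ₁ s a s' ≠ 0) →
      ∀ θ₂, M.prob t θ₂ s a s' ≠ 0 ∧
        DifferentiableAt ℝ (fun η => Real.log (M.prob t η s a s')) θ₂)
    (hbdd : ∃ C : ℝ, ∀ᶠ θ₁ in 𝓝 θ, ∀ t < T, ∀ s a s', M.prob t θ₁ s a s' ≠ 0 →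
      ‖gradient (fun η => Real.log (M.prob t η s a s')) θ₁‖ ≤ C) :
    ∃ r C, M.RegularAt T θ r C := by
  obtain ⟨C, hC⟩ := hbdd
  obtain ⟨r, hr, hball⟩ := Metric.eventually_nhds_iff_ball.1 hC
  refine ⟨min r 1, max C 0, lt_min hr one_pos, min_le_right _ _, le_max_right _ _, ?_, ?_, ?_⟩
  · exact fun t ht s a s' η η' hη => (hdiff t ht s a s' ⟨η, hη⟩ η').1
  · exact fun t ht s a s' hθ η => (hdiff t ht s a s' ⟨θ, hθ⟩ η).2
  · intro η hη t ht s a s' hθ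
    exact (hball η (Metric.ball_subset_ball (min_le_left _ _) hη) t ht s a s'
      (hdiff t ht s a s' ⟨θ, hθ⟩ η).1).trans (le_max_left _ _)

/-- The properties of the value function which propagate backwards in time. -/
structure ValueRegularAt (M : ParamMDP E νA νS) (T : ℕ) (α : ℝ) (t : ℕ) (θ : E) (r K : ℝ) :
    Prop where
  one_le : 1 ≤ K
  measurable_value : ∀ η ∈ Metric.ball θ r, Measurable fun s => M.value T α t s η
  abs_value_le : ∀ s, |M.value T α t s θ| ≤ K * (M.absCost T t s θ).toReal
  abs_value_sub_le : ∀ s, ∀ η ∈ Metric.ball θ r,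
    |M.value T α t s η - M.value T α t s θ| ≤ K * (M.absCost T t s θ).toReal * ‖η - θ‖
  differentiableAt : ∀ s, DifferentiableAt ℝ (fun η => M.value T α t s η) θ

theorem valueRegularAt_terminal (M : ParamMDP E νA νS) (T : ℕ) (α : ℝ) (θ : E) (r : ℝ) :
    M.ValueRegularAt T α T θ r 1 where
  one_le := le_rfl
  measurable_value := by simp [value_terminal]
  abs_value_le := by simp [value_terminal]
  abs_value_sub_le s η _ := by
    simp only [value_terminal, sub_self, abs_zero]
    positivity
  differentiableAt := by simp [value_terminal]

theorem aestronglyMeasurable_gradient_value {α K : ℝ} (hV : M.ValueRegularAt T α t θ r K)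
    (hr : 0 < r) (ν : Measure S) :
    AEStronglyMeasurable (fun s => gradient (fun η => M.value T α t s η) θ) ν :=
  aestronglyMeasurable_of_hasGradientAt hr (fun η hη => (hV.measurable_value η hη).aemeasurable)
    (Eventually.of_forall fun s => (hV.differentiableAt s).hasGradientAt)

theorem RegularAt.ratio_eq_exp (h : M.RegularAt T θ r C) (ht : t < T) {s : S} {x : A × S}
    (hx : M.prob t θ s x.1 x.2 ≠ 0) (η : E) : M.ratio t θ s η x =
      Real.exp (Real.log (M.prob t η s x.1 x.2) - Real.log (M.prob t θ s x.1 x.2)) := by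
  have pos : ∀ η, 0 < M.prob t η s x.1 x.2 := fun η =>
    lt_of_le_of_ne (M.prob_nonneg _ _ _ _ _) (h.prob_ne_zero t ht _ _ _ _ η hx).symm
  rw [Real.exp_sub, Real.exp_log (pos _), Real.exp_log (pos _), ratio]

namespace RegularAt

/-- Because the support is the same for all parameters, the ratio recovers the density; where both
densities vanish, the convention `0 / 0 = 0` is harmless. -/
theorem law_eq (h : M.RegularAt T θ r C) (ht : t < T) (s : S) (η : E) :
    M.law t η s = densMeasure (M.law t θ s) (M.ratio t θ s η) := by
  rw [densMeasure, law, law, ← withDensity_mul _ (M.measurable_prob_right t θ s).ennreal_ofReal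
    (M.measurable_ratio t θ s η).ennreal_ofReal]
  congr 1
  funext x
  rw [Pi.mul_apply, ← ENNReal.ofReal_mul (M.prob_nonneg _ _ _ _ _), ratio]
  congr 1
  by_cases h0 : M.prob t θ s x.1 x.2 = 0
  · rw [h0, zero_mul]
    by_contra hne
    exact h.prob_ne_zero t ht _ _ _ _ θ hne h0
  · field_simp

theorem hasGradientAt_ratio (h : M.RegularAt T θ r C) (ht : t < T) {s : S} {x : A × S}
    (hx : M.prob t θ s x.1 x.2 ≠ 0) : HasGradientAt (fun η => M.ratio t θ s η x)
      (gradient (fun η => Real.log (M.prob t η s x.1 x.2)) θ) θ := by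
  have h1 := (h.differentiableAt t ht s x.1 x.2 hx θ).hasGradientAt
  have h2 := (h1.hasFDerivAt.sub_const (Real.log (M.prob t θ s x.1 x.2))).exp
  simp only [h.ratio_eq_exp ht hx]
  rw [sub_self, Real.exp_zero, one_smul] at h2
  exact hasGradientAt_iff_hasFDerivAt.2 h2

/-- The mean value inequality bounds the log-ratio `d` by `C ‖η - θ‖`, which is at most `C` because
`r ≤ 1`. The rest is `|exp d - 1| ≤ |d| exp |d|`. -/
theorem abs_ratio_sub_one_le (h : M.RegularAt T θ r C) (ht : t < T) {s : S} {x : A × S}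
    (hx : M.prob t θ s x.1 x.2 ≠ 0) {η : E} (hη : η ∈ Metric.ball θ r) :
    |M.ratio t θ s η x - 1| ≤ C * Real.exp C * ‖η - θ‖ := by
  have h1 : ‖Real.log (M.prob t η s x.1 x.2) - Real.log (M.prob t θ s x.1 x.2)‖ ≤ C * ‖η - θ‖ := by
    refine (convex_ball θ r).norm_image_sub_le_of_norm_fderiv_le (𝕜 := ℝ)
      (f := fun η => Real.log (M.prob t η s x.1 x.2))
      (fun y _ => h.differentiableAt t ht s x.1 x.2 hx y) (fun y hy => ?_)
      (Metric.mem_ball_self h.r_pos) hη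
    have := h.norm_gradient_le y hy t ht s x.1 x.2 hx
    rwa [gradient, LinearIsometryEquiv.norm_map] at this
  rw [h.ratio_eq_exp ht hx]
  set d := Real.log (M.prob t η s x.1 x.2) - Real.log (M.prob t θ s x.1 x.2)
  rw [Real.norm_eq_abs] at h1
  have hn : ‖η - θ‖ ≤ 1 := (mem_ball_iff_norm.1 hη).le.trans h.r_le_one
  have hC := h.C_nonneg
  have h2 : |d| ≤ C := h1.trans (mul_le_of_le_one_right hC hn)
  have h3 : |Real.exp d - 1| ≤ |d| * Real.exp |d| := by
    have a1 := Real.add_one_le_exp d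
    have a2 := Real.add_one_le_exp (-d)
    rcases le_total 0 d with hd | hd
    · rw [abs_of_nonneg hd, abs_of_nonneg (by linarith)]
      have a3 : Real.exp d * Real.exp (-d) = 1 := by rw [← Real.exp_add]; simp
      nlinarith [Real.exp_pos d]
    · rw [abs_of_nonpos hd, abs_of_nonpos (by linarith [Real.exp_le_one_iff.2 hd])]
      have a3 : 1 ≤ Real.exp (-d) := Real.one_le_exp (by linarith)
      nlinarith
  calc |Real.exp d - 1| ≤ |d| * Real.exp |d| := h3
    _ ≤ (C * ‖η - θ‖) * Real.exp C :=
      mul_le_mul h1 (Real.exp_le_exp.2 h2) (Real.exp_pos _).le (by positivity)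
    _ = _ := by ring

end RegularAt

variable [SigmaFinite νA] [SigmaFinite νS]

/-- The ratio is one at `θ`, so its gradient there is the score. The value at `t + 1` and its
increments are bounded by expected future costs under `θ` alone; with `1 ≤ K`, which absorbs the
current cost, a single `W` dominates both. -/
theorem ValueRegularAt.regularFamily {α K : ℝ} (hV : M.ValueRegularAt T α (t + 1) θ r K)
    (h : M.RegularAt T θ r C) (hmom : ∀ t < T, ∀ s, M.absCost T t s θ < ∞) (ht : t < T) (s : S) :
    RegularFamily (M.law t θ s) θ r (C * Real.exp C) (M.ratio t θ s)
      (fun η x => M.riskToGo T α t s η x)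
      (fun x => K * (|M.cost t s x.1 x.2| + (M.absCost T (t + 1) x.2 θ).toReal))
      (fun x => gradient (fun η => Real.log (M.prob t η s x.1 x.2)) θ)
      (fun x => gradient (fun η => M.value T α (t + 1) x.2 η) θ) where
  r_pos := h.r_pos
  r_le_one := h.r_le_one
  C_nonneg := mul_nonneg h.C_nonneg (Real.exp_pos _).le
  W_nonneg x := by
    have := hV.one_le
    positivity
  integrable_W := (M.integrable_absCost hmom ht s).1.const_mul K
  measurable_dens := M.measurable_ratio t θ s
  dens_nonneg := M.ratio_nonneg t θ s
  isProbabilityMeasure η := by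
    have := M.isProbabilityMeasure_law t η s
    rwa [h.law_eq ht s η] at this
  dens_self := by
    filter_upwards [M.ae_prob_ne_zero t θ s] with x hx using div_self hx
  dens_lip := by
    filter_upwards [M.ae_prob_ne_zero t θ s] with x hx η hη using h.abs_ratio_sub_one_le ht hx hη
  dens_grad := by
    filter_upwards [M.ae_prob_ne_zero t θ s] with x hx using h.hasGradientAt_ratio ht hx
  measurable_var η hη := (measurable_riskToGo (hV.measurable_value η hη)).comp measurable_prodMk_left
  var_le x := by
    rw [riskToGo, mul_add]
    refine (abs_add_le _ _).trans (add_le_add ?_ (hV.abs_value_le _))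
    exact le_mul_of_one_le_left (abs_nonneg _) hV.one_le
  var_lip := Eventually.of_forall fun x η hη => by
    rw [riskToGo, riskToGo, add_sub_add_left_eq_sub]
    refine (hV.abs_value_sub_le x.2 η hη).trans
      (mul_le_mul_of_nonneg_right (mul_le_mul_of_nonneg_left ?_ ?_) (norm_nonneg _))
    · exact le_add_of_nonneg_left (abs_nonneg _)
    · linarith [hV.one_le]
  var_grad := Eventually.of_forall fun x => by
    rw [hasGradientAt_iff_hasFDerivAt]
    exact (hV.differentiableAt x.2).hasGradientAt.hasFDerivAt.const_add _

/-- In the last period no uniqueness is required, since the terminal value is identically zero and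
so is its gradient. -/
theorem integral_smul_gradient_value_eq {α K : ℝ}
    (hV : M.ValueRegularAt T α (t + 1) θ r K) (h : M.RegularAt T θ r C)
    (hsaddle : t + 1 < T → ∀ s, ∀ (ξ₁ ξ₂ : A × S → ℝ) (l₁ l₂ : ℝ),
      IsSaddlePoint (M.law t θ s) (M.riskToGo T α t s θ) α ξ₁ l₁ →
      IsSaddlePoint (M.law t θ s) (M.riskToGo T α t s θ) α ξ₂ l₂ →
      ∀ B : Set S, MeasurableSet B →
        ∫ x in {x | x.2 ∈ B}, ξ₁ x ∂(M.law t θ s) = ∫ x in {x | x.2 ∈ B}, ξ₂ x ∂(M.law t θ s))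
    (ht : t < T) (s : S) (ξ₁ ξ₂ : A × S → ℝ) (l₁ l₂ : ℝ)
    (h₁ : IsSaddlePoint (M.law t θ s) (M.riskToGo T α t s θ) α ξ₁ l₁)
    (h₂ : IsSaddlePoint (M.law t θ s) (M.riskToGo T α t s θ) α ξ₂ l₂) :
    ∫ x, ξ₁ x • gradient (fun η => M.value T α (t + 1) x.2 η) θ ∂(M.law t θ s) =
      ∫ x, ξ₂ x • gradient (fun η => M.value T α (t + 1) x.2 η) θ ∂(M.law t θ s) := by
  rcases eq_or_lt_of_le (Nat.succ_le_of_lt ht) with hT | hT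
  · have : ∀ x : A × S, gradient (fun η => M.value T α (t + 1) x.2 η) θ = 0 := fun x => by
      rw [show t + 1 = T from hT]
      simp only [value_terminal]
      exact gradient_const θ 0
    simp only [this, smul_zero]
  · have := M.isProbabilityMeasure_law t θ s
    exact integral_smul_comp_snd_eq h₁.1 h₂.1 (hsaddle hT s ξ₁ ξ₂ l₁ l₂ h₁ h₂)
      (Y := fun s => gradient (fun η => M.value T α (t + 1) s η) θ)
      (aestronglyMeasurable_gradient_value hV h.r_pos)

end Regular
end ParamMDP

namespace ParamMDP

/-! ### Backward induction -/

section Backward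

variable {E A S : Type*} [NormedAddCommGroup E] [InnerProductSpace ℝ E] [FiniteDimensional ℝ E]
  [MeasurableSpace A] [MeasurableSpace S]
  {νA : Measure A} {νS : Measure S} [SigmaFinite νA] [SigmaFinite νS] {T t : ℕ} {θ : E} {r C : ℝ}
  {M : ParamMDP E νA νS} {α K : ℝ}

theorem RegularAt.value_eq_CVaR (h : M.RegularAt T θ r C) (ht : t < T) (α : ℝ) (s : S) :
    (fun η => M.value T α t s η) = fun η =>
      CVaR (densMeasure (M.law t θ s) (M.ratio t θ s η)) (M.riskToGo T α t s η) α := by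
  funext η
  rw [M.value_eq ht, h.law_eq ht s η]

theorem ValueRegularAt.backward (hV : M.ValueRegularAt T α (t + 1) θ r K)
    (h : M.RegularAt T θ r C) (hα0 : 0 < α) (hα1 : α < 1)
    (hmom : ∀ t < T, ∀ s, M.absCost T t s θ < ∞)
    (hquant : ∀ t < T, ∀ s, ∀ q₁ q₂ : ℝ,
      IsQuantile (M.law t θ s) (M.riskToGo T α t s θ) α q₁ →
      IsQuantile (M.law t θ s) (M.riskToGo T α t s θ) α q₂ → q₁ = q₂)
    (hsaddle : ∀ t, t + 1 < T → ∀ s, ∀ (ξ₁ ξ₂ : A × S → ℝ) (l₁ l₂ : ℝ),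
      IsSaddlePoint (M.law t θ s) (M.riskToGo T α t s θ) α ξ₁ l₁ →
      IsSaddlePoint (M.law t θ s) (M.riskToGo T α t s θ) α ξ₂ l₂ →
      ∀ B : Set S, MeasurableSet B →
        ∫ x in {x | x.2 ∈ B}, ξ₁ x ∂(M.law t θ s) = ∫ x in {x | x.2 ∈ B}, ξ₂ x ∂(M.law t θ s))
    (ht : t < T) : ∃ K', M.ValueRegularAt T α t θ r K' := by
  have fam := fun s => hV.regularFamily h hmom ht s
  have hK := hV.one_le
  have hC : 0 ≤ C * Real.exp C := mul_nonneg h.C_nonneg (Real.exp_pos _).le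
  have h1α : 0 < 1 - α := by linarith
  -- The recursion for `absCost` closes the induction: the mean of the dominating function is again
  -- `K` times the expected absolute cost, one period earlier.
  have hW : ∀ s, ∫ x, K * (|M.cost t s x.1 x.2| + (M.absCost T (t + 1) x.2 θ).toReal)
      ∂(M.law t θ s) = K * (M.absCost T t s θ).toReal := fun s => by
    rw [integral_const_mul, (M.integrable_absCost hmom ht s).2]
  set K₁ := 1 / (1 - α) * ((1 + 2 * (C * Real.exp C)) *
    (1 + 1 / (α * (1 - α)) * (2 * (1 + C * Real.exp C)))) with hK₁
  have hK₁0 : 0 ≤ K₁ := by positivity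
  have hK₂0 : 0 ≤ 1 / (1 - α) := by positivity
  -- The three summands serve, in turn, `1 ≤ K'`, the Lipschitz bound and the bound on the value
  -- itself.
  refine ⟨1 + K₁ * K + 1 / (1 - α) * K, ⟨?_, ?_, ?_, ?_, ?_⟩⟩
  · have : 0 ≤ K₁ * K := by positivity
    have : 0 ≤ 1 / (1 - α) * K := by positivity
    linarith
  · intro η hη
    have e : (fun s => M.value T α t s η) = fun s => CVaR (M.law t η s)
        (M.riskToGo T α t s η) α := funext fun s => M.value_eq ht α s η
    rw [e]
    refine M.measurable_CVaR_law t η hα0 hα1 (measurable_riskToGo (hV.measurable_value η hη))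
      fun s => ?_
    rw [h.law_eq ht s η]
    exact (fam s).integrable_var hη
  · intro s
    have := M.isProbabilityMeasure_law t θ s
    have hi := (fam s).integrable_var_self
    rw [M.value_eq ht]
    refine (abs_CVaR_le ((fam s).measurable_var θ (fam s).mem_ball) hi hα0 hα1).trans ?_
    have h2 := integral_mono hi.abs (fam s).integrable_W (fam s).var_le
    rw [hW] at h2
    have h3 : 0 ≤ (1 + K₁ * K) * (M.absCost T t s θ).toReal := by positivity
    calc 1 / (1 - α) * ∫ x, |M.riskToGo T α t s θ x| ∂(M.law t θ s)
        ≤ 1 / (1 - α) * (K * (M.absCost T t s θ).toReal) := mul_le_mul_of_nonneg_left h2 hK₂0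
      _ ≤ _ := by linarith
  · intro s η hη
    have h2 := (fam s).abs_CVaR_sub_le hα0 hα1 hη
    rw [← h.law_eq ht, ← M.value_eq ht, ← M.value_eq ht, hW] at h2
    refine h2.trans (mul_le_mul_of_nonneg_right ?_ (norm_nonneg _))
    have h3 : 0 ≤ (1 + 1 / (1 - α) * K) * (M.absCost T t s θ).toReal := by positivity
    linarith
  · intro s
    have := M.isProbabilityMeasure_law t θ s
    have hm := (fam s).measurable_var θ (fam s).mem_ball
    obtain ⟨ξ, -, -, hξ⟩ := exists_isSaddlePoint hm (fam s).integrable_var_self hα1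
      (isQuantile_VaR hm hα0 hα1)
    rw [h.value_eq_CVaR ht]
    exact ((fam s).hasGradientAt_CVaR hα0 hα1 (hquant t ht s)
      (integral_smul_gradient_value_eq hV h (hsaddle t) ht s) hξ).differentiableAt

theorem exists_valueRegularAt (h : M.RegularAt T θ r C) (hα0 : 0 < α) (hα1 : α < 1)
    (hmom : ∀ t < T, ∀ s, M.absCost T t s θ < ∞)
    (hquant : ∀ t < T, ∀ s, ∀ q₁ q₂ : ℝ,
      IsQuantile (M.law t θ s) (M.riskToGo T α t s θ) α q₁ →
      IsQuantile (M.law t θ s) (M.riskToGo T α t s θ) α q₂ → q₁ = q₂)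
    (hsaddle : ∀ t, t + 1 < T → ∀ s, ∀ (ξ₁ ξ₂ : A × S → ℝ) (l₁ l₂ : ℝ),
      IsSaddlePoint (M.law t θ s) (M.riskToGo T α t s θ) α ξ₁ l₁ →
      IsSaddlePoint (M.law t θ s) (M.riskToGo T α t s θ) α ξ₂ l₂ →
      ∀ B : Set S, MeasurableSet B →
        ∫ x in {x | x.2 ∈ B}, ξ₁ x ∂(M.law t θ s) = ∫ x in {x | x.2 ∈ B}, ξ₂ x ∂(M.law t θ s))
    (ht : t ≤ T) : ∃ K, M.ValueRegularAt T α t θ r K := by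
  induction ht using Nat.decreasingInduction with
  | of_succ k hk ih =>
    obtain ⟨K, hK⟩ := ih
    exact hK.backward h hα0 hα1 hmom hquant hsaddle hk
  | self => exact ⟨1, valueRegularAt_terminal M T α θ r⟩

end Backward
end ParamMDP

end

/-! ### The gradient formula -/

theorem mainTheorem2 {d : ℕ} {A S : Type*} [MeasurableSpace A] [MeasurableSpace S]
    {νA : Measure A} {νS : Measure S} [SigmaFinite νA] [SigmaFinite νS]
    (M : ParamMDP (EuclideanSpace ℝ (Fin d)) νA νS) (T : ℕ)
    (α : ℝ) (hα0 : 0 < α) (hα1 : α < 1) (θ : EuclideanSpace ℝ (Fin d))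
    -- the logarithm of a transition probability that is not zero is differentiable in `θ`
    (hdiff : ∀ t < T, ∀ s a s', (∃ θ₁, M.prob t θ₁ s a s' ≠ 0) →
      ∀ θ₂, M.prob t θ₂ s a s' ≠ 0 ∧
        DifferentiableAt ℝ (fun η => Real.log (M.prob t η s a s')) θ₂)
    -- its gradient is bounded
    (hbdd : ∃ C : ℝ, ∀ᶠ θ₁ in 𝓝 θ, ∀ t < T, ∀ s a s', M.prob t θ₁ s a s' ≠ 0 →
      ‖gradient (fun η => Real.log (M.prob t η s a s')) θ₁‖ ≤ C)
    -- the costs have finite first moments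
    (hmom : ∀ t < T, ∀ s, M.absCost T t s θ < ∞)
    -- the running risk-to-go has a unique `α`-quantile
    (hquant : ∀ t < T, ∀ s, ∀ q₁ q₂ : ℝ,
      IsQuantile (M.law t θ s) (M.riskToGo T α t s θ) α q₁ →
      IsQuantile (M.law t θ s) (M.riskToGo T α t s θ) α q₂ → q₁ = q₂)
    -- the reweighted law of the next state is the same for all saddle-points
    (hsaddle : ∀ t, t + 1 < T → ∀ s, ∀ (ξ₁ ξ₂ : A × S → ℝ) (l₁ l₂ : ℝ),
      IsSaddlePoint (M.law t θ s) (M.riskToGo T α t s θ) α ξ₁ l₁ →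
      IsSaddlePoint (M.law t θ s) (M.riskToGo T α t s θ) α ξ₂ l₂ →
      ∀ B : Set S, MeasurableSet B →
        ∫ x in {x | x.2 ∈ B}, ξ₁ x ∂(M.law t θ s) = ∫ x in {x | x.2 ∈ B}, ξ₂ x ∂(M.law t θ s)) :
    ∀ t < T, ∀ s : S,
      (∃ (ξ : A × S → ℝ) (l : ℝ),
        IsSaddlePoint (M.law t θ s) (M.riskToGo T α t s θ) α ξ l) ∧
      ∀ (ξ : A × S → ℝ) (l : ℝ),
        IsSaddlePoint (M.law t θ s) (M.riskToGo T α t s θ) α ξ l →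
        IsQuantile (M.law t θ s) (M.riskToGo T α t s θ) α l ∧
        (t + 1 = T →
          Integrable (fun x => max (M.cost t s x.1 x.2 - l) 0 •
            gradient (fun η => Real.log (M.policy t η s x.1)) θ) (M.law t θ s) ∧
          HasGradientAt (fun η => M.value T α t s η)
            ((1 / (1 - α)) • ∫ x, max (M.cost t s x.1 x.2 - l) 0 •
              gradient (fun η => Real.log (M.policy t η s x.1)) θ ∂(M.law t θ s)) θ) ∧
        (t + 1 < T →
          Integrable (fun x => max (M.cost t s x.1 x.2 + M.value T α (t + 1) x.2 θ - l) 0 •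
            gradient (fun η => Real.log (M.policy t η s x.1)) θ) (M.law t θ s) ∧
          Integrable (fun x => ξ x • gradient (fun η => M.value T α (t + 1) x.2 η) θ)
            (M.law t θ s) ∧
          HasGradientAt (fun η => M.value T α t s η)
            ((1 / (1 - α)) • ∫ x, max (M.cost t s x.1 x.2 + M.value T α (t + 1) x.2 θ - l) 0 •
                gradient (fun η => Real.log (M.policy t η s x.1)) θ ∂(M.law t θ s) +
              ∫ x, ξ x • gradient (fun η => M.value T α (t + 1) x.2 η) θ ∂(M.law t θ s)) θ) := by
  obtain ⟨r, C, h⟩ := ParamMDP.exists_regularAt hdiff hbdd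
  intro t ht s
  obtain ⟨K, hV⟩ := ParamMDP.exists_valueRegularAt h hα0 hα1 hmom hquant hsaddle
    (Nat.succ_le_of_lt ht)
  have fam := hV.regularFamily h hmom ht s
  have := M.isProbabilityMeasure_law t θ s
  have hm := fam.measurable_var θ fam.mem_ball
  have hi := fam.integrable_var_self
  refine ⟨?_, fun ξ l hs => ⟨hs.isQuantile hm hi hα1, ?_⟩⟩
  · obtain ⟨ξ, -, -, hξ⟩ := exists_isSaddlePoint hm hi hα1 (isQuantile_VaR hm hα0 hα1)
    exact ⟨ξ, _, hξ⟩
  have hgrad := fam.hasGradientAt_CVaR hα0 hα1 (hquant t ht s)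
    (ParamMDP.integral_smul_gradient_value_eq hV h (hsaddle t) ht s) hs
  rw [← h.value_eq_CVaR ht] at hgrad
  have hint := fam.integrable_posPart_smul l
  -- The envelope theorem yields the score of the joint density; almost surely the latter is
  -- nonzero, and there its score is that of the policy.
  have hae : (fun x : A × S => max (M.riskToGo T α t s θ x - l) 0 •
      gradient (fun η => Real.log (M.prob t η s x.1 x.2)) θ) =ᵐ[M.law t θ s]
      fun x => max (M.riskToGo T α t s θ x - l) 0 •
        gradient (fun η => Real.log (M.policy t η s x.1)) θ := by
    filter_upwards [M.ae_prob_ne_zero t θ s] with x hx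
    rw [h.gradient_log_policy ht hx]
  have hint' := hint.congr hae
  rw [integral_congr_ae hae] at hgrad
  refine ⟨fun hT => ?_, fun _ => ⟨hint', hs.1.integrable_smul fam.integrable_Y, hgrad⟩⟩
  have hX : ∀ x : A × S, M.riskToGo T α t s θ x = M.cost t s x.1 x.2 := fun x => by
    rw [ParamMDP.riskToGo, hT, ParamMDP.value_terminal, add_zero]
  have hY : ∀ x : A × S, gradient (fun η => M.value T α (t + 1) x.2 η) θ = 0 := fun x => by
    rw [hT]
    simp only [ParamMDP.value_terminal]
    exact gradient_const θ 0
  simp only [hX, hY, smul_zero, integral_zero, add_zero] at hint' hgrad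
  exact ⟨hint', hgrad⟩
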